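/- Let $B$ be the open unit ball of $\mathbb{R}^4$, let $\beta\in(0,1)$, $w(x)=\big(\log\frac{e}{|x|}\big)^{\beta}$, $\gamma=\frac{2}{1-\beta}$ and $\alpha_\beta=4\,[8\pi^2(1-\beta)]^{\frac1{1-\beta}}$. Let $\mathbf{E}$ be the closure of the radial functions in $C_0^\infty(B)$ for the norm $\|u\|=\big(\int_B w|\Delta u|^2dx\big)^{1/2}$: that is, $u\in\mathbf{E}$ if and only if $u\in L^2(B)$ has a weak Laplacian $\Delta u\in L^2(B,w\,dx)$ and there are radial $\varphi_n\in C_0^\infty(B)$ with $\varphi_n\to u$ in $L^2(B)$ and $\Delta\varphi_n\to\Delta u$ in $L^2(B,w\,dx)$. Let $f:B\times\mathbb{R}\to\mathbb{R}$ and $F(x,t)=\int_0^t f(x,s)\,ds$. Assume that $f$ has critical growth: for some $\alpha_0>0$, $$\lim_{|s|\to\infty}\frac{|f(x,s)|}{e^{\alpha |s|^\gamma}}=0\ \text{ uniformly in }x\in B,\text{ for all }\alpha>\alpha_0,\qquad \lim_{s\to+\infty}\frac{|f(x,s)|}{e^{\alpha s^\gamma}}=+\infty\ \text{ for all }x\in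 B\text{ and all }\alpha<\alpha_0 .$$ Assume also: - $(V_1)$ $f$ is continuous on $B\times\mathbb{R}$ and radial in $x$; - $(V_2)$ there is $\theta>2$ with $0<\theta F(x,t)\le t f(x,t)$ for all $x\in B$, $t\neq0$; - $(V_3)$ for each $x\in B$, $t\mapsto f(x,t)/|t|$ is strictly increasing on $\mathbb{R}\setminus\{0\}$; - $(V_4)$ for each $x\in B$, $\lim_{t\to0}|f(x,t)|/|t|=0$; - $(V_5)$ there are $p>\theta$ and $C_p>1$ with $\operatorname{sgn}(t)f(x,t)\ge C_p|t|^{p-1}$ for all $(x,t)\in B\times\mathbb{R}$. Put $J_p(u)=\frac12\|u\|^2-\frac1p\int_B|u|^pdx$, $\mathcal{N}_p=\{u\in\mathbf{E}\setminus\{0\}:\ \|u\|^2=\int_B|u|^pdx\}$, $m_p=\inf_{\mathcal{N}_p}J_p$, and suppose that for some $\delta>0$ $$C_p>\max\left\{1,\left(\frac{2\theta\, m_p}{\theta-2}\Big(\frac{2(\alpha_0+\delta)}{\alpha_\beta}\Big)^{1-\beta}\right)^{\frac{p-2}{2}}\right\}.$$ Then $m_p>0$, and the problem $\Delta(w\Delta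 u)=f(x,u)$ in $B$, $u=\frac{\partial u}{\partial n}=0$ on $\partial B$, has a radial ground-state weak solution: there is a radial $u\in\mathbf{E}$, $u\ne0$, such that for every $\varphi\in\mathbf{E}$ the function $f(x,u)\varphi$ is integrable on $B$ and $$\int_B w\,\Delta u\,\Delta\varphi\,dx=\int_B f(x,u)\varphi\,dx ,$$ and $u$ minimizes $\mathcal{J}(v)=\frac12\|v\|^2-\int_BF(x,v)\,dx$ over the Nehari set $\mathcal{N}=\{v\in\mathbf{E}\setminus\{0\}:\ \|v\|^2=\int_B f(x,v)v\,dx\}$, to which $u$ belongs. -/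

import Mathlib

open MeasureTheory Set Filter Topology
open scoped ContDiff Laplacian

noncomputable section

namespace WeightedBiharmonic

/-- Four-dimensional Euclidean space. -/
abbrev R4 : Type := EuclideanSpace ℝ (Fin 4)

/-- The open unit ball of `ℝ⁴`. -/
def B : Set R4 := Metric.ball (0 : R4) 1

/-- The weight `w(x) = (log (e / |x|)) ^ β`. -/
def w (β : ℝ) (x : R4) : ℝ := Real.log (Real.exp 1 / ‖x‖) ^ β

/-- The measure `w(x) dx` on the unit ball, so that `L²(B, w)` is `L²` of this measure. -/
def weightedMeasure (β : ℝ) : Measure R4 :=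
  (volume.restrict B).withDensity (fun x => ENNReal.ofReal (w β x))

/-- The exponent `γ = 2 / (1 - β)`. -/
def gammaExp (β : ℝ) : ℝ := 2 / (1 - β)

/-- The sharp constant `α_β = 4 (8 π² (1 - β)) ^ (1 / (1 - β))` of the weighted Adams inequality. -/
def alphaSharp (β : ℝ) : ℝ := 4 * (8 * Real.pi ^ 2 * (1 - β)) ^ (1 / (1 - β))

/-- A function is radial if its value at `x` depends on `|x|` only. -/
def IsRadial (u : R4 → ℝ) : Prop := ∀ x y : R4, ‖x‖ = ‖y‖ → u x = u y

/-- `C₀^∞(B)`: smooth functions with compact support contained in the open ball. -/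
structure IsTest (φ : R4 → ℝ) : Prop where
  smooth : ContDiff ℝ ∞ φ
  compact : HasCompactSupport φ
  supp : tsupport φ ⊆ B

/-- `g` is the distributional Laplacian of `u` in `B`. -/
def IsWeakLaplacian (u g : R4 → ℝ) : Prop :=
  LocallyIntegrableOn u B ∧ LocallyIntegrableOn g B ∧
    ∀ φ : R4 → ℝ, IsTest φ → ∫ x in B, u x * (Δ φ) x = ∫ x in B, g x * φ x

open Classical in
/-- The weak Laplacian of `u` in `B` (unique up to a null set when it exists, and `0` by convention
when `u` has none). -/
def lap (u : R4 → ℝ) : R4 → ℝ :=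
  if h : ∃ g, IsWeakLaplacian u g then h.choose else 0

/-- The space `𝐄 = W_{0,rad}^{2,2}(B, w)`: the closure of the radial functions of `C₀^∞(B)` for the
norm `(∫_B w |Δu|²)^{1/2}`. A function `u ∈ L²(B)` with weak Laplacian `Δu ∈ L²(B, w)` belongs to it
if there are radial test functions `φ n` with `φ n → u` in `L²(B)` and `Δ(φ n) → Δu` in `L²(B, w)`.
On radial test functions `∫_B w |Δφ|²` dominates the squared norms of `φ` and of its gradient in
`L²(B)`, so that convergence of `φ n` and of the gradients comes along with that of the Laplacians.
Elements are functions, considered up to equality almost everywhere in `B`. -/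
def E (β : ℝ) : Set (R4 → ℝ) :=
  {u | MemLp u 2 (volume.restrict B) ∧
    (∃ g, IsWeakLaplacian u g) ∧
    MemLp (lap u) 2 (weightedMeasure β) ∧
    ∃ φ : ℕ → R4 → ℝ, (∀ n, IsTest (φ n) ∧ IsRadial (φ n)) ∧
      Tendsto (fun n => eLpNorm (u - φ n) 2 (volume.restrict B)) atTop (𝓝 0) ∧
      Tendsto (fun n => eLpNorm (lap u - Δ (φ n)) 2 (weightedMeasure β)) atTop (𝓝 0)}

/-- The scalar product `⟨u, v⟩ = ∫_B w Δu Δv dx` of `𝐄`; thus `‖u‖² = ⟨u, u⟩`. -/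
def ip (β : ℝ) (u v : R4 → ℝ) : ℝ := ∫ x in B, w β x * lap u x * lap v x

/-- The primitive `F(x, t) = ∫₀ᵗ f(x, s) ds`. -/
def primitive (f : R4 → ℝ → ℝ) (x : R4) (t : ℝ) : ℝ := ∫ s in (0 : ℝ)..t, f x s

/-- The energy `J(u) = ½ ‖u‖² - ∫_B F(x, u) dx`. -/
def J (β : ℝ) (f : R4 → ℝ → ℝ) (u : R4 → ℝ) : ℝ :=
  1 / 2 * ip β u u - ∫ x in B, primitive f x (u x)

/-- The derivative `⟨J'(u), φ⟩ = ∫_B w Δu Δφ dx - ∫_B f(x, u) φ dx`. -/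
def J' (β : ℝ) (f : R4 → ℝ → ℝ) (u φ : R4 → ℝ) : ℝ :=
  ip β u φ - ∫ x in B, f x (u x) * φ x

/-- The Nehari set `{u ∈ 𝐄 : u ≠ 0, ⟨J'(u), u⟩ = 0}`. -/
def nehari (β : ℝ) (f : R4 → ℝ → ℝ) : Set (R4 → ℝ) :=
  {u | u ∈ E β ∧ ¬ (u =ᵐ[volume.restrict B] 0) ∧ J' β f u u = 0}

/-- Weak solutions of `Δ(w Δu) = f(x, u)` in `B`, `u = ∂u/∂n = 0` on `∂B`: functions `u ∈ 𝐄` with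
`∫_B w Δu Δφ dx = ∫_B f(x, u) φ dx` for all `φ ∈ 𝐄`, the integrals being finite. -/
def IsWeakSolution (β : ℝ) (f : R4 → ℝ → ℝ) (u : R4 → ℝ) : Prop :=
  u ∈ E β ∧ ∀ φ ∈ E β, IntegrableOn (fun x => f x (u x) * φ x) B ∧
    ip β u φ = ∫ x in B, f x (u x) * φ x

/-- The auxiliary energy `J_p(u) = ½ ‖u‖² - (1/p) ∫_B |u|^p dx`. -/
def Jp (β p : ℝ) (u : R4 → ℝ) : ℝ :=
  1 / 2 * ip β u u - 1 / p * ∫ x in B, |u x| ^ p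

/-- The Nehari set of `J_p`: here `⟨J_p'(u), u⟩ = ‖u‖² - ∫_B |u|^p dx`. -/
def nehariP (β p : ℝ) : Set (R4 → ℝ) :=
  {u | u ∈ E β ∧ ¬ (u =ᵐ[volume.restrict B] 0) ∧ ip β u u - ∫ x in B, |u x| ^ p = 0}

/-- The ground-state level `m_p = inf J_p` over the Nehari set of `J_p`. -/
def mp (β p : ℝ) : ℝ := sInf (Jp β p '' nehariP β p)

/-- Critical exponential growth with threshold `α₀`: `|f(x, s)| e^{-α |s|^γ}` tends to `0` as
`|s| → ∞`, uniformly in `x`, for every `α > α₀`, and `|f(x, s)| e^{-α s^γ}` tends to `∞` as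
`s → +∞` for every `α < α₀`. -/
structure HasCriticalGrowth (β α₀ : ℝ) (f : R4 → ℝ → ℝ) : Prop where
  upper : ∀ α, α₀ < α →
    TendstoUniformlyOn (fun (s : ℝ) (x : R4) => |f x s| / Real.exp (α * |s| ^ gammaExp β))
      (fun _ => 0) (atBot ⊔ atTop) B
  lower : ∀ α, α < α₀ → ∀ x ∈ B,
    Tendsto (fun s : ℝ => |f x s| / Real.exp (α * s ^ gammaExp β)) atTop atTop

end WeightedBiharmonic

end

open WeightedBiharmonic

noncomputable section

namespace WeightedBiharmonic

/-! The proof replaces a function of `𝐄` by its Laplacian. A radial test function satisfies `φ(x) =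
-(1/4π²) ∫_B max(|x|,|y|)⁻² Δφ(y) dy` (`IsTest.eq_integral_greenKernel`), with no boundary term
since `φ` and its gradient vanish at the sphere. Hence `𝐄` is a closed subspace `lapSpace` of the
Hilbert space `L²(B, w)`, and evaluation at any `x ≠ 0` in `B` is a bounded functional on it
(`mem_E_of_ae_eq_evalG`, `exists_mem_lapSpace`). The norm of that functional is computed explicitly,
and Cauchy–Schwarz gives `|u(x)| ≤ (8π²(1-β))^(-1/2) ‖u‖ (log (e/|x|))^((1-β)/2)` (`abs_evalG_le`).

The power `γ` turns this bound into a logarithm, so `exp(α|u|^γ)` is at most a constant times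
`|x|^(-q)` with `q = α (radialConst β ‖u‖)^γ`. This is integrable when `q < 4`, that is, when `α
‖u‖^γ < α_β`. Below this threshold a whole bounded set of `𝐄` has one integrable majorant. Weak
convergence implies pointwise convergence, so all compactness reduces to dominated convergence.

On the Nehari set, condition `(V₂)` gives `(1/2 - 1/θ)‖u‖² ≤ J(u)`, so a minimising sequence is
subcritical as soon as the infimum is small. The size of `C_p` ensures this: almost minimisers of
`J_p` are moved along rays to the Nehari set of `f`, and `F ≥ C_p |t|^p / p` bounds the energy there
by `C_p^(-2/(p-2)) J_p` (`exists_energy_le`, `exists_subcritical`). The weak limit is nonzero and is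
projected down its ray to the Nehari set. The monotonicity of `f(x,t)/|t|` shows that this does not
raise the energy above the infimum (`primitive_ray`, `exists_minimizer`).

As `f` is merely continuous, Lagrange multipliers on the Nehari set are not at hand. A minimiser is
shown to be critical by perturbing its ray: a direction of descent would produce a Nehari point of
lower energy (`dEnergy_eq_zero_of_minimizer`). -/

/-! ### Radial test functions: Laplacian and Green representation. -/

/-- The radial profile `t ↦ φ (t e₀)`. -/
def profile (φ : R4 → ℝ) (t : ℝ) : ℝ := φ (t • EuclideanSpace.single (0 : Fin 4) (1 : ℝ))

lemma IsRadial.eq_profile {φ : R4 → ℝ} (h : IsRadial φ) (x : R4) : φ x = profile φ ‖x‖ :=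
  h _ _ (by simp [norm_smul])

lemma contDiff_profile {φ : R4 → ℝ} (h : ContDiff ℝ ∞ φ) : ContDiff ℝ ∞ (profile φ) :=
  h.comp (contDiff_id.smul contDiff_const)

lemma hasDerivAt_profile {φ : R4 → ℝ} (h : ContDiff ℝ ∞ φ) (t : ℝ) :
    HasDerivAt (profile φ) (deriv (profile φ) t) t :=
  ((contDiff_profile h).differentiable (by simp) t).hasDerivAt

lemma contDiff_deriv_profile {φ : R4 → ℝ} (h : ContDiff ℝ ∞ φ) :
    ContDiff ℝ ∞ (deriv (profile φ)) :=
  (contDiff_infty_iff_deriv.1 (contDiff_profile h)).2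

lemma hasDerivAt_deriv_profile {φ : R4 → ℝ} (h : ContDiff ℝ ∞ φ) (t : ℝ) :
    HasDerivAt (deriv (profile φ)) (deriv (deriv (profile φ)) t) t :=
  ((contDiff_deriv_profile h).differentiable (by simp) t).hasDerivAt

/-- The second derivative of a radial function in the direction `e`. -/
lemma IsRadial.iteratedFDeriv_two {φ : R4 → ℝ} (hφ : ContDiff ℝ ∞ φ) (h : IsRadial φ)
    {x : R4} (hx : x ≠ 0) (e : R4) :
    iteratedFDeriv ℝ 2 φ x ![e, e] =
      deriv (deriv (profile φ)) ‖x‖ * (inner ℝ x e / ‖x‖) ^ 2 +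
        deriv (profile φ) ‖x‖ * (‖e‖ ^ 2 / ‖x‖ - inner ℝ x e ^ 2 / ‖x‖ ^ 3) := by
  have hx0 : (0 : ℝ) < ‖x‖ := norm_pos_iff.2 hx
  -- Everything is differentiated along this line, near `s = 0`, where the norm stays
  -- differentiable.
  set c : ℝ → R4 := fun s => x + s • e with hc
  have hcd : ∀ s, HasDerivAt c e s := fun s => by
    have := ((hasDerivAt_id s).smul_const e).const_add x
    rwa [one_smul] at this
  have hc0 : c 0 = x := by simp [hc]
  have hne : ∀ᶠ s in 𝓝 (0 : ℝ), c s ≠ 0 :=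
    (hcd 0).continuousAt.eventually_ne (by simpa [hc0] using hx)
  have hnorm : ∀ s, c s ≠ 0 → HasDerivAt (fun s => ‖c s‖) (inner ℝ (c s) e / ‖c s‖) s := by
    intro s hs
    have h1 : HasDerivAt (fun s => ‖c s‖ ^ 2) (2 * inner ℝ (c s) e) s := (hcd s).norm_sq
    have h2 := h1.sqrt (by simpa using hs)
    have h3 : (fun s => √(‖c s‖ ^ 2)) = fun s => ‖c s‖ := by ext s; simp
    rw [h3] at h2
    convert h2 using 1
    rw [Real.sqrt_sq (norm_nonneg _)]
    field_simp
  have hd1 : ∀ s, c s ≠ 0 → fderiv ℝ φ (c s) e =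
      deriv (profile φ) ‖c s‖ * (inner ℝ (c s) e / ‖c s‖) := by
    intro s hs
    have h1 : HasDerivAt (fun s => φ (c s)) (fderiv ℝ φ (c s) e) s :=
      (hφ.differentiable (by simp) (c s)).hasFDerivAt.comp_hasDerivAt s (hcd s)
    have h2 : (fun s => φ (c s)) = fun s => profile φ ‖c s‖ := by
      ext s; exact h.eq_profile _
    rw [h2] at h1
    exact h1.unique ((hasDerivAt_profile hφ _).comp s (hnorm s hs))
  have hd2 : HasDerivAt (fun s => fderiv ℝ φ (c s) e)
      (fderiv ℝ (fderiv ℝ φ) x e e) 0 := by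
    have h1 : DifferentiableAt ℝ (fderiv ℝ φ) x :=
      (hφ.fderiv_right (m := 1) (by norm_cast)).differentiable (by simp) x
    have h2 : HasDerivAt (fun s => fderiv ℝ φ (c s)) (fderiv ℝ (fderiv ℝ φ) x e) 0 := by
      have h3 := h1.hasFDerivAt
      rw [← hc0] at h3
      have h4 := h3.comp_hasDerivAt (0 : ℝ) (hcd 0)
      rw [hc0] at h4
      exact h4
    simpa using h2.clm_apply (hasDerivAt_const (0 : ℝ) e)
  have hx0' : c 0 ≠ 0 := by rwa [hc0]
  have hin : HasDerivAt (fun s => inner ℝ (c s) e) (‖e‖ ^ 2) 0 := by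
    simpa using (hcd 0).inner ℝ (hasDerivAt_const (0 : ℝ) e)
  have hd3 : HasDerivAt (fun s => deriv (profile φ) ‖c s‖ * (inner ℝ (c s) e / ‖c s‖))
      _ 0 :=
    ((hasDerivAt_deriv_profile hφ _).comp (0 : ℝ) (hnorm 0 hx0')).mul
      (hin.div (hnorm 0 hx0') (norm_ne_zero_iff.2 hx0'))
  have hd4 := hd3.congr_of_eventuallyEq (hne.mono fun s hs => hd1 s hs)
  rw [iteratedFDeriv_two_apply]
  simp only [Matrix.cons_val_zero, Matrix.cons_val_one]
  rw [hd2.unique hd4, Function.comp_apply, hc0]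
  field_simp

/-- The Laplacian of a smooth radial function on `ℝ⁴`. -/
lemma IsRadial.laplacian_eq {φ : R4 → ℝ} (hφ : ContDiff ℝ ∞ φ) (h : IsRadial φ)
    {x : R4} (hx : x ≠ 0) :
    (Δ φ) x = deriv (deriv (profile φ)) ‖x‖ + 3 / ‖x‖ * deriv (profile φ) ‖x‖ := by
  have hx0 : (0 : ℝ) < ‖x‖ := norm_pos_iff.2 hx
  rw [InnerProductSpace.laplacian_eq_iteratedFDeriv_orthonormalBasis φ
    (EuclideanSpace.basisFun (Fin 4) ℝ)]
  have hsum : ∑ i, (x i) ^ 2 = ‖x‖ ^ 2 := by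
    rw [EuclideanSpace.norm_eq, Real.sq_sqrt (by positivity)]; simp
  simp only [h.iteratedFDeriv_two hφ hx, EuclideanSpace.basisFun_apply,
    PiLp.norm_single, EuclideanSpace.inner_single_right]
  simp only [Fin.sum_univ_four] at hsum ⊢
  simp only [norm_one, one_mul, conj_trivial]
  field_simp
  linear_combination (-deriv (profile φ) ‖x‖ + ‖x‖ * deriv (deriv (profile φ)) ‖x‖) * hsum

/-- Green's representation of the profile of a radial function that vanishes near the sphere. -/
lemma profile_representation {φ : R4 → ℝ} (hφ : ContDiff ℝ ∞ φ)
    (h1 : profile φ 1 = 0) (h1' : deriv (profile φ) 1 = 0) {r : ℝ} (hr : 0 < r) (hr1 : r < 1) :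
    ∫ t in Ioo (0 : ℝ) 1, t ^ 3 * ((max r t)⁻¹ ^ 2 *
      (deriv (deriv (profile φ)) t + 3 / t * deriv (profile φ) t)) = -2 * profile φ r := by
  set g := profile φ with hg
  have hc1 : Continuous (deriv g) := (contDiff_deriv_profile hφ).continuous
  have hc2 : Continuous (deriv (deriv g)) :=
    (contDiff_infty_iff_deriv.1 (contDiff_deriv_profile hφ)).2.continuous
  -- The maximum splits the integral at `r`, and both halves are exact derivatives: of `t³ g'` below
  -- `r`, of `2g + t g'` above. The terms with `g'(r)` cancel.
  have e1 : ∫ t in (0 : ℝ)..r, (3 * t ^ 2 * deriv g t + t ^ 3 * deriv (deriv g) t) =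
      r ^ 3 * deriv g r := by
    rw [intervalIntegral.integral_eq_sub_of_hasDerivAt (f := fun t => t ^ 3 * deriv g t)]
    · simp
    · intro t _
      exact (hasDerivAt_pow 3 t).mul (hasDerivAt_deriv_profile hφ t)
    · exact (by fun_prop : Continuous _).intervalIntegrable _ _
  have e2 : ∫ t in r..1, (3 * deriv g t + t * deriv (deriv g) t) =
      -2 * g r - r * deriv g r := by
    rw [intervalIntegral.integral_eq_sub_of_hasDerivAt
      (f := fun t => 2 * g t + t * deriv g t)]
    · rw [h1, h1']; ring
    · intro t _
      have := ((hasDerivAt_profile hφ t).const_mul 2).add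
        ((hasDerivAt_id t).mul (hasDerivAt_deriv_profile hφ t))
      refine this.congr_deriv ?_
      simp only [id, ← hg]; ring
    · exact (by fun_prop : Continuous _).intervalIntegrable _ _
  have hE1 : EqOn (fun t => r⁻¹ ^ 2 * (3 * t ^ 2 * deriv g t + t ^ 3 * deriv (deriv g) t))
      (fun t : ℝ => t ^ 3 * ((max r t)⁻¹ ^ 2 * (deriv (deriv g) t + 3 / t * deriv g t)))
      (Ioc 0 r) := by
    intro t ht
    have := ht.1
    simp only [max_eq_left ht.2]
    field_simp
    ring
  have hE2 : EqOn (fun t => (3 * deriv g t + t * deriv (deriv g) t))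
      (fun t : ℝ => t ^ 3 * ((max r t)⁻¹ ^ 2 * (deriv (deriv g) t + 3 / t * deriv g t)))
      (Ioc r 1) := by
    intro t ht
    have : 0 < t := hr.trans ht.1
    simp only [max_eq_right ht.1.le]
    field_simp
    ring
  have i1 : IntegrableOn (fun t => r⁻¹ ^ 2 * (3 * t ^ 2 * deriv g t + t ^ 3 * deriv (deriv g) t))
      (Ioc 0 r) := (by fun_prop : Continuous _).integrableOn_Ioc
  have i2 : IntegrableOn (fun t => (3 * deriv g t + t * deriv (deriv g) t))
      (Ioc r 1) := (by fun_prop : Continuous _).integrableOn_Ioc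
  rw [← integral_Ioc_eq_integral_Ioo, ← Ioc_union_Ioc_eq_Ioc hr.le hr1.le,
    setIntegral_union (Set.disjoint_left.2 fun t h h' => (h.2.trans_lt h'.1).false)
      measurableSet_Ioc (i1.congr_fun hE1 measurableSet_Ioc)
      (i2.congr_fun hE2 measurableSet_Ioc),
    ← setIntegral_congr_fun measurableSet_Ioc hE1, ← setIntegral_congr_fun measurableSet_Ioc hE2,
    ← intervalIntegral.integral_of_le hr.le, ← intervalIntegral.integral_of_le hr1.le,
    intervalIntegral.integral_const_mul, e1, e2]
  field_simp
  ring

/-- Integrals over the ball in polar coordinates. -/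
lemma setIntegral_B_norm (F : ℝ → ℝ) :
    ∫ x in B, F ‖x‖ = 2 * Real.pi ^ 2 * ∫ t in Ioo (0 : ℝ) 1, t ^ 3 * F t := by
  have h1 : ∫ x in B, F ‖x‖ = ∫ x : R4, (Iio (1 : ℝ)).indicator F ‖x‖ := by
    rw [← integral_indicator (by exact measurableSet_ball)]
    congr 1; ext x
    simp [indicator, B]
  have hvol : (volume : Measure R4).real (Metric.ball 0 1) = Real.pi ^ 2 / 2 := by
    have hk : Module.finrank ℝ R4 = 2 * 2 := by simp
    rw [Measure.real, InnerProductSpace.volume_ball_of_dim_even hk]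
    simp only [ENNReal.ofReal_one, one_pow, one_mul]
    rw [ENNReal.toReal_ofReal (by positivity)]
    norm_num [Nat.factorial]
  rw [h1, integral_fun_norm_addHaar, hvol]
  have h2 : ∀ y : ℝ, y ^ (Module.finrank ℝ R4 - 1) • (Iio (1 : ℝ)).indicator F y =
      (Iio (1 : ℝ)).indicator (fun t => t ^ 3 * F t) y := by
    intro y
    by_cases hy : y < 1 <;> simp [indicator, hy]
  simp only [h2]
  rw [setIntegral_indicator measurableSet_Iio, Ioi_inter_Iio]
  simp only [finrank_euclideanSpace, Fintype.card_fin, smul_eq_mul, nsmul_eq_mul]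
  push_cast
  ring

lemma IsTest.profile_one {φ : R4 → ℝ} (h : IsTest φ) :
    profile φ 1 = 0 ∧ deriv (profile φ) 1 = 0 := by
  have hn : EuclideanSpace.single (0 : Fin 4) (1 : ℝ) ∉ tsupport φ := fun hh => by
    have := h.supp hh
    simp [B] at this
  have h0 : (fun x => φ x) =ᶠ[𝓝 (EuclideanSpace.single (0 : Fin 4) (1 : ℝ))] 0 :=
    notMem_tsupport_iff_eventuallyEq.1 hn
  have hp : profile φ =ᶠ[𝓝 1] 0 := by
    have hc : Tendsto (fun t : ℝ => t • EuclideanSpace.single (0 : Fin 4) (1 : ℝ)) (𝓝 1)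
        (𝓝 (EuclideanSpace.single (0 : Fin 4) (1 : ℝ))) := by
      have : Continuous fun t : ℝ => t • EuclideanSpace.single (0 : Fin 4) (1 : ℝ) := by fun_prop
      simpa using this.tendsto 1
    exact hc.eventually h0
  exact ⟨hp.eq_of_nhds, by rw [hp.deriv_eq]; simp⟩

/-- The radial Green function of the bilaplacian factorisation. -/
def greenKernel (r t : ℝ) : ℝ := -(1 / (4 * Real.pi ^ 2)) * (max r t)⁻¹ ^ 2

/-- A radial test function is recovered from its Laplacian. -/
lemma IsTest.eq_integral_greenKernel {φ : R4 → ℝ} (h : IsTest φ) (hr : IsRadial φ) {x : R4}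
    (hx : x ∈ B) (hx0 : x ≠ 0) :
    φ x = ∫ y in B, greenKernel ‖x‖ ‖y‖ * (Δ φ) y := by
  have hx1 : ‖x‖ < 1 := by simpa [B] using hx
  have h1 : ∫ y in B, greenKernel ‖x‖ ‖y‖ * (Δ φ) y =
      ∫ y in B, (fun t => greenKernel ‖x‖ t *
        (deriv (deriv (profile φ)) t + 3 / t * deriv (profile φ) t)) ‖y‖ := by
    refine integral_congr_ae ?_
    have : ∀ᵐ y ∂(volume.restrict B : Measure R4), y ≠ 0 :=
      ae_restrict_of_ae (by simp [ae_iff, measure_singleton])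
    filter_upwards [this] with y hy
    rw [hr.laplacian_eq h.smooth hy]
  have h2 := profile_representation h.smooth h.profile_one.1 h.profile_one.2
    (norm_pos_iff.2 hx0) hx1
  rw [h1, setIntegral_B_norm (fun t => greenKernel ‖x‖ t *
    (deriv (deriv (profile φ)) t + 3 / t * deriv (profile φ) t)), hr.eq_profile]
  have h3 : ∀ t : ℝ, t ^ 3 * (greenKernel ‖x‖ t *
      (deriv (deriv (profile φ)) t + 3 / t * deriv (profile φ) t)) =
      -(1 / (4 * Real.pi ^ 2)) * (t ^ 3 * ((max ‖x‖ t)⁻¹ ^ 2 *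
      (deriv (deriv (profile φ)) t + 3 / t * deriv (profile φ) t))) := by
    intro t; unfold greenKernel; ring
  simp only [h3]
  rw [integral_const_mul, h2]
  field_simp
  ring

/-! ### The weight and integrability at the origin. -/

/-- The logarithm `log (e / |x|)`. -/
def logInv (x : R4) : ℝ := Real.log (Real.exp 1 / ‖x‖)

/-- The growth `(log (e / |x|)) ^ ((1 - β) / 2)` of the elements of `𝐄` at the origin. -/
def psi (β : ℝ) (x : R4) : ℝ := logInv x ^ ((1 - β) / 2)

lemma measurableSet_B : MeasurableSet B := measurableSet_ball

lemma ae_mem_B_ne_zero : ∀ᵐ x ∂(volume.restrict B : Measure R4), x ∈ B ∧ x ≠ 0 := by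
  have : ∀ᵐ y ∂(volume.restrict B : Measure R4), y ≠ 0 :=
    ae_restrict_of_ae (by simp [ae_iff, measure_singleton])
  filter_upwards [ae_restrict_mem measurableSet_B, this] with x h1 h2 using ⟨h1, h2⟩

lemma logInv_eq {x : R4} (hx : x ≠ 0) : logInv x = 1 - Real.log ‖x‖ := by
  rw [logInv, Real.log_div (Real.exp_ne_zero 1) (norm_ne_zero_iff.2 hx), Real.log_exp]

lemma one_le_logInv {x : R4} (hx : x ∈ B) (hx0 : x ≠ 0) : 1 ≤ logInv x := by
  rw [logInv_eq hx0]
  have : ‖x‖ < 1 := by simpa [B] using hx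
  have := Real.log_nonpos (norm_nonneg x) this.le
  linarith

lemma w_eq (β : ℝ) (x : R4) : w β x = logInv x ^ β := rfl

lemma one_le_w {β : ℝ} (hβ : 0 < β) {x : R4} (hx : x ∈ B) (hx0 : x ≠ 0) : 1 ≤ w β x :=
  Real.one_le_rpow (one_le_logInv hx hx0) hβ.le

lemma measurable_logInv : Measurable logInv := by
  unfold logInv; fun_prop

lemma measurable_w (β : ℝ) : Measurable (w β) := measurable_logInv.pow_const β

lemma measurable_psi (β : ℝ) : Measurable (psi β) := measurable_logInv.pow_const _

lemma psi_nonneg {β : ℝ} {x : R4} (hx : x ∈ B) (hx0 : x ≠ 0) : 0 ≤ psi β x :=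
  Real.rpow_nonneg (zero_le_one.trans (one_le_logInv hx hx0)) _

lemma psi_rpow_gammaExp {β : ℝ} (hβ1 : β < 1) {x : R4} (hx : x ∈ B) (hx0 : x ≠ 0) :
    psi β x ^ gammaExp β = logInv x := by
  have h0 : (0 : ℝ) < 1 - β := by linarith
  rw [psi, ← Real.rpow_mul (zero_le_one.trans (one_le_logInv hx hx0)), gammaExp]
  rw [show (1 - β) / 2 * (2 / (1 - β)) = 1 by field_simp, Real.rpow_one]

/-- Negative powers of the norm are integrable on the ball below the dimension. -/
lemma integrableOn_norm_rpow {q : ℝ} (hq : q < 4) :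
    IntegrableOn (fun x : R4 => ‖x‖ ^ (-q)) B := by
  unfold B
  rw [integrableOn_fun_norm_addHaar volume (f := fun t : ℝ => t ^ (-q)) (r := 1)]
  have h1 : IntegrableOn (fun t : ℝ => t ^ (3 - q)) (Ioo 0 1) := by
    rw [intervalIntegral.integrableOn_Ioo_rpow_iff one_pos]; linarith
  refine h1.congr_fun (fun t ht => ?_) measurableSet_Ioo
  have h3 : (3 : ℝ) = ((3 : ℕ) : ℝ) := by norm_num
  simp only [finrank_euclideanSpace, Fintype.card_fin, smul_eq_mul]
  rw [sub_eq_add_neg, Real.rpow_add ht.1, h3, Real.rpow_natCast]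

lemma logInv_le_rpow {ε : ℝ} (hε : 0 < ε) {x : R4} (hx : x ∈ B) (hx0 : x ≠ 0) :
    logInv x ≤ (1 + 1 / ε) * ‖x‖ ^ (-ε) := by
  have hn : 0 < ‖x‖ := norm_pos_iff.2 hx0
  have hn1 : ‖x‖ < 1 := by simpa [B] using hx
  have h1 := Real.log_le_rpow_div (inv_nonneg.2 hn.le) hε
  rw [Real.log_inv, Real.inv_rpow hn.le, ← Real.rpow_neg hn.le] at h1
  have h2 : 1 ≤ ‖x‖ ^ (-ε) := Real.one_le_rpow_of_pos_of_le_one_of_nonpos hn hn1.le (by linarith)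
  rw [logInv_eq hx0]
  calc 1 - Real.log ‖x‖ ≤ ‖x‖ ^ (-ε) + ‖x‖ ^ (-ε) / ε := by linarith
    _ = _ := by ring

lemma exp_mul_logInv {q : ℝ} {x : R4} (hx0 : x ≠ 0) :
    Real.exp (q * logInv x) = Real.exp q * ‖x‖ ^ (-q) := by
  rw [logInv_eq hx0, Real.rpow_def_of_pos (norm_pos_iff.2 hx0), ← Real.exp_add]
  congr 1; ring

/-- The integrability at the origin behind the subcritical Adams inequality. -/
lemma integrableOn_logInv_rpow_mul_exp {k q : ℝ} (hk : 0 ≤ k) (hq : q < 4) :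
    IntegrableOn (fun x => logInv x ^ k * Real.exp (q * logInv x)) B := by
  -- Bounding the logarithm by a multiple of `|x|^(-ε)` costs `εk` in the exponent; this `ε` uses up
  -- less than half of the gap `4 - q`.
  set ε := (4 - q) / (2 * (k + 1)) with hε
  have hε0 : 0 < ε := by apply div_pos <;> linarith
  have hkε : ε * k + q < 4 := by
    have : ε * (k + 1) = (4 - q) / 2 := by rw [hε]; field_simp
    nlinarith
  have h1 := (integrableOn_norm_rpow hkε).const_mul ((1 + 1 / ε) ^ k * Real.exp q)
  refine Integrable.mono' h1
    ((measurable_logInv.pow_const k).mul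
      (measurable_logInv.const_mul q).exp).aestronglyMeasurable ?_
  filter_upwards [ae_mem_B_ne_zero] with x ⟨hx, hx0⟩
  have hL := one_le_logInv hx hx0
  have hn : 0 < ‖x‖ := norm_pos_iff.2 hx0
  rw [Real.norm_of_nonneg (by positivity), exp_mul_logInv hx0]
  have h2 : logInv x ^ k ≤ (1 + 1 / ε) ^ k * ‖x‖ ^ (-(ε * k)) := by
    refine (Real.rpow_le_rpow (by linarith) (logInv_le_rpow hε0 hx hx0) hk).trans_eq ?_
    rw [Real.mul_rpow (by positivity) (by positivity), ← Real.rpow_mul hn.le]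
    congr 2; ring
  calc logInv x ^ k * (Real.exp q * ‖x‖ ^ (-q))
      ≤ ((1 + 1 / ε) ^ k * ‖x‖ ^ (-(ε * k))) * (Real.exp q * ‖x‖ ^ (-q)) := by gcongr
    _ = (1 + 1 / ε) ^ k * Real.exp q * ‖x‖ ^ (-(ε * k + q)) := by
      rw [neg_add, Real.rpow_add hn]; ring

lemma integrableOn_w {β : ℝ} (hβ : 0 < β) : IntegrableOn (w β) B := by
  have := integrableOn_logInv_rpow_mul_exp hβ.le (show (0 : ℝ) < 4 by norm_num)
  simpa [← w_eq] using this

lemma isFiniteMeasure_weightedMeasure {β : ℝ} (hβ : 0 < β) :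
    IsFiniteMeasure (weightedMeasure β) :=
  isFiniteMeasure_withDensity_ofReal (integrableOn_w hβ).2

lemma weightedMeasure_absolutelyContinuous (β : ℝ) :
    weightedMeasure β ≪ volume.restrict B := withDensity_absolutelyContinuous _ _

/-- Holds because `w ≥ 1` on the ball. Weighted convergence therefore implies unweighted
convergence, and the two measures have the same null sets. -/
lemma restrict_le_weightedMeasure {β : ℝ} (hβ : 0 < β) :
    (volume.restrict B : Measure R4) ≤ weightedMeasure β := by
  rw [← withDensity_one (μ := (volume.restrict B : Measure R4)), weightedMeasure]
  refine withDensity_mono ?_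
  filter_upwards [ae_mem_B_ne_zero] with x ⟨hx, hx0⟩
  simpa using one_le_w hβ hx hx0

lemma ae_weightedMeasure_iff {β : ℝ} (hβ : 0 < β) {P : R4 → Prop} :
    (∀ᵐ x ∂(weightedMeasure β), P x) ↔ ∀ᵐ x ∂(volume.restrict B), P x :=
  ⟨fun h => (Measure.absolutelyContinuous_of_le (restrict_le_weightedMeasure hβ)).ae_le h,
    fun h => (weightedMeasure_absolutelyContinuous β).ae_le h⟩

lemma ae_weightedMeasure_mem_B_ne_zero {β : ℝ} (hβ : 0 < β) :
    ∀ᵐ x ∂(weightedMeasure β), x ∈ B ∧ x ≠ 0 :=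
  (ae_weightedMeasure_iff hβ).2 ae_mem_B_ne_zero

lemma integral_weightedMeasure {β : ℝ} (hβ : 0 < β) (g : R4 → ℝ) :
    ∫ x, g x ∂(weightedMeasure β) = ∫ x in B, w β x * g x := by
  rw [weightedMeasure, integral_withDensity_eq_integral_toReal_smul
    (measurable_w β).ennreal_ofReal (by simp)]
  refine integral_congr_ae ?_
  filter_upwards [ae_mem_B_ne_zero] with x ⟨hx, hx0⟩
  rw [ENNReal.toReal_ofReal (by linarith [one_le_w hβ hx hx0]), smul_eq_mul]

/-! ### Point evaluations as vectors of `L²(B, w)`, and the radial lemma. -/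

/-- The Hilbert space `L²(B, w)`. -/
abbrev WL2 (β : ℝ) := Lp ℝ 2 (weightedMeasure β)

/-- The representer in `L²(B, w)` of the evaluation on the sphere of radius `r`. -/
def evalKernel (β r : ℝ) (y : R4) : ℝ := greenKernel r ‖y‖ / w β y

lemma abs_greenKernel_le {r : ℝ} (hr : 0 < r) (t : ℝ) :
    |greenKernel r t| ≤ 1 / (4 * Real.pi ^ 2) * r⁻¹ ^ 2 := by
  rw [greenKernel, abs_mul, abs_neg, abs_of_nonneg (by positivity), abs_of_nonneg (by positivity)]
  have : (max r t)⁻¹ ≤ r⁻¹ := inv_anti₀ hr (le_max_left _ _)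
  have h0 : 0 ≤ (max r t)⁻¹ := inv_nonneg.2 (hr.le.trans (le_max_left _ _))
  gcongr

lemma measurable_greenKernel (r : ℝ) : Measurable (greenKernel r) := by
  unfold greenKernel; fun_prop

lemma memLp_evalKernel {β r : ℝ} (hβ : 0 < β) (hr : 0 < r) :
    MemLp (evalKernel β r) 2 (weightedMeasure β) := by
  have := isFiniteMeasure_weightedMeasure hβ
  refine MemLp.of_bound ?_ (1 / (4 * Real.pi ^ 2) * r⁻¹ ^ 2) ?_
  · exact (((measurable_greenKernel r).comp measurable_norm).div
      (measurable_w β)).aestronglyMeasurable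
  · filter_upwards [ae_weightedMeasure_mem_B_ne_zero hβ] with x ⟨hx, hx0⟩
    have h1 := one_le_w hβ hx hx0
    rw [evalKernel, norm_div, Real.norm_eq_abs, Real.norm_of_nonneg (by linarith)]
    exact (div_le_self (abs_nonneg _) h1).trans (abs_greenKernel_le hr _)

open Classical in
/-- The representer `evalKernel` as an element of `L²(B, w)`. -/
def evalVec (β r : ℝ) : WL2 β :=
  -- For `r > 0` the kernel is bounded and the measure finite, so the value `0` is not taken there.
  if h : MemLp (evalKernel β r) 2 (weightedMeasure β) then h.toLp else 0

lemma evalVec_ae {β r : ℝ} (hβ : 0 < β) (hr : 0 < r) :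
    evalVec β r =ᵐ[weightedMeasure β] evalKernel β r := by
  rw [evalVec, dif_pos (memLp_evalKernel hβ hr)]
  exact MemLp.coeFn_toLp _

/-- The pointwise value at `x` of the function in `𝐄` whose Laplacian is `h`. -/
def evalG (β : ℝ) (h : WL2 β) (x : R4) : ℝ := inner ℝ (evalVec β ‖x‖) h

lemma inner_evalVec {β r : ℝ} (hβ : 0 < β) (hr : 0 < r) (h : WL2 β) :
    inner ℝ (evalVec β r) h = ∫ y in B, greenKernel r ‖y‖ * h y := by
  rw [L2.inner_def]
  have h1 : (∫ a, inner ℝ (evalVec β r a) (h a) ∂(weightedMeasure β)) =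
      ∫ a, evalKernel β r a * h a ∂(weightedMeasure β) := by
    refine integral_congr_ae ?_
    filter_upwards [evalVec_ae hβ hr] with y hy
    rw [hy]; simp [mul_comm]
  rw [h1, integral_weightedMeasure hβ]
  refine integral_congr_ae ?_
  filter_upwards [ae_mem_B_ne_zero] with y ⟨hy, hy0⟩
  have := one_le_w hβ hy hy0
  rw [evalKernel]
  field_simp

lemma evalG_laplacian {β : ℝ} (hβ : 0 < β) {φ : R4 → ℝ} (hφ : IsTest φ) (hr : IsRadial φ)
    {h : WL2 β} (hh : h =ᵐ[weightedMeasure β] Δ φ) {x : R4} (hx : x ∈ B) (hx0 : x ≠ 0) :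
    evalG β h x = φ x := by
  rw [evalG, inner_evalVec hβ (norm_pos_iff.2 hx0), hφ.eq_integral_greenKernel hr hx hx0]
  refine integral_congr_ae ?_
  filter_upwards [(ae_weightedMeasure_iff hβ).1 hh] with y hy
  rw [hy]

/-- Up to a constant this is the squared norm of the evaluation functional. Above `r` the integrand
is `(1 - log t)^(-β) / t`, an exact derivative whose boundary term at `1` is `-1/(1-β)`. That term
absorbs the part below `r`, which is at most `1/4`, so the leading constant is not spoiled. -/
lemma integral_kernel_le {β : ℝ} (hβ : 0 < β) (hβ1 : β < 1) {r : ℝ} (hr : 0 < r) (hr1 : r < 1) :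
    ∫ t in Ioo (0 : ℝ) 1, t ^ 3 * ((max r t)⁻¹ ^ 4 * (1 - Real.log t) ^ (-β)) ≤
      (1 - Real.log r) ^ (1 - β) / (1 - β) := by
  have hlog : ∀ t ∈ Ioc (0 : ℝ) 1, 1 ≤ 1 - Real.log t := fun t ht => by
    have := Real.log_nonpos ht.1.le ht.2; linarith
  have hβ' : 0 < 1 - β := by linarith
  set F : ℝ → ℝ := fun t => t ^ 3 * ((max r t)⁻¹ ^ 4 * (1 - Real.log t) ^ (-β)) with hF
  have hmeas : Measurable F := by fun_prop
  have hle : ∀ t ∈ Ioc (0 : ℝ) 1, F t ≤ t ^ 3 * r⁻¹ ^ 4 ∧ 0 ≤ F t := by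
    intro t ht
    have h1 : (1 - Real.log t) ^ (-β) ≤ 1 :=
      Real.rpow_le_one_of_one_le_of_nonpos (hlog t ht) (by linarith)
    have h0 : 0 ≤ (1 - Real.log t) ^ (-β) := Real.rpow_nonneg (by linarith [hlog t ht]) _
    have h2 : (max r t)⁻¹ ≤ r⁻¹ := inv_anti₀ hr (le_max_left _ _)
    have h3 : 0 ≤ (max r t)⁻¹ := inv_nonneg.2 (hr.le.trans (le_max_left _ _))
    have ht0 := ht.1
    refine ⟨?_, by positivity⟩
    calc F t ≤ t ^ 3 * (r⁻¹ ^ 4 * 1) := by simp only [hF]; gcongr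
      _ = _ := by ring
  have hint : IntegrableOn F (Ioc 0 1) := by
    refine Integrable.mono' (g := fun t => t ^ 3 * r⁻¹ ^ 4)
      ((by fun_prop : Continuous _).integrableOn_Ioc) hmeas.aestronglyMeasurable ?_
    filter_upwards [ae_restrict_mem measurableSet_Ioc] with t ht
    rw [Real.norm_of_nonneg (hle t ht).2]
    exact (hle t ht).1
  have i1 : IntegrableOn F (Ioc 0 r) := hint.mono_set (Ioc_subset_Ioc_right hr1.le)
  have i2 : IntegrableOn F (Ioc r 1) := hint.mono_set (Ioc_subset_Ioc_left hr.le)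
  rw [← integral_Ioc_eq_integral_Ioo, ← Ioc_union_Ioc_eq_Ioc hr.le hr1.le,
    setIntegral_union (Set.disjoint_left.2 fun t h h' => (h.2.trans_lt h'.1).false)
      measurableSet_Ioc i1 i2]
  have e1 : ∫ t in Ioc 0 r, F t ≤ 1 / 4 := by
    calc ∫ t in Ioc 0 r, F t ≤ ∫ t in Ioc 0 r, t ^ 3 * r⁻¹ ^ 4 := by
          refine setIntegral_mono_on i1 ((by fun_prop : Continuous _).integrableOn_Ioc)
            measurableSet_Ioc fun t ht => (hle t ⟨ht.1, ht.2.trans hr1.le⟩).1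
      _ = 1 / 4 := by
          rw [← intervalIntegral.integral_of_le hr.le, intervalIntegral.integral_mul_const,
            integral_pow]
          field_simp
          norm_num
          ring
  have e2 : ∫ t in Ioc r 1, F t = ((1 - Real.log r) ^ (1 - β) - 1) / (1 - β) := by
    rw [← intervalIntegral.integral_of_le hr1.le,
      intervalIntegral.integral_eq_sub_of_hasDerivAt
        (f := fun t => -((1 - Real.log t) ^ (1 - β) / (1 - β)))]
    · simp; ring
    · intro t ht
      rw [uIcc_of_le hr1.le] at ht
      have ht0 : 0 < t := hr.trans_le ht.1
      have hl := hlog t ⟨ht0, ht.2⟩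
      have h1 := ((((Real.hasDerivAt_log ht0.ne').const_sub 1).rpow_const
        (p := 1 - β) (Or.inl (by linarith))).div_const (1 - β)).neg
      refine h1.congr_deriv ?_
      simp only [hF, max_eq_right ht.1]
      rw [show 1 - β - 1 = -β by ring]
      field_simp
    · rw [intervalIntegrable_iff_integrableOn_Ioc_of_le hr1.le]
      exact i2
  rw [e2]
  have h5 : (1 : ℝ) / 4 ≤ 1 / (1 - β) :=
    one_div_le_one_div_of_le hβ' (by linarith)
  rw [sub_div]
  linarith

/-- The constant `(8 π² (1 - β)) ^ (-1/2)` of the radial lemma. -/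
def radialConst (β : ℝ) : ℝ := √(1 / (8 * Real.pi ^ 2 * (1 - β)))

/-- The squared norm is `∫_B greenKernel² / w`; in polar coordinates the factor is `2π² / (16π⁴) = 1
/ (8π²)`, the source of the constant in `α_β`. -/
lemma norm_evalVec_le {β : ℝ} (hβ : 0 < β) (hβ1 : β < 1) {x : R4} (hx : x ∈ B) (hx0 : x ≠ 0) :
    ‖evalVec β ‖x‖‖ ≤ radialConst β * psi β x := by
  have hn : 0 < ‖x‖ := norm_pos_iff.2 hx0
  have hn1 : ‖x‖ < 1 := by simpa [B] using hx
  have hL := one_le_logInv hx hx0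
  have hβ' : 0 < 1 - β := by linarith
  have hsq : ‖evalVec β ‖x‖‖ ^ 2 ≤ 1 / (8 * Real.pi ^ 2 * (1 - β)) * logInv x ^ (1 - β) := by
    rw [← real_inner_self_eq_norm_sq, inner_evalVec hβ hn]
    have h1 : ∫ y in B, greenKernel ‖x‖ ‖y‖ * evalVec β ‖x‖ y =
        ∫ y in B, (fun t => 1 / (16 * Real.pi ^ 4) *
          ((max ‖x‖ t)⁻¹ ^ 4 * (1 - Real.log t) ^ (-β))) ‖y‖ := by
      refine integral_congr_ae ?_
      filter_upwards [(ae_weightedMeasure_iff hβ).1 (evalVec_ae hβ hn), ae_mem_B_ne_zero]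
        with y hy ⟨hyB, hy0⟩
      have hLy := one_le_logInv hyB hy0
      rw [hy, evalKernel, w_eq, ← logInv_eq hy0, Real.rpow_neg (by linarith), greenKernel]
      field_simp
      ring
    rw [h1, setIntegral_B_norm (fun t => 1 / (16 * Real.pi ^ 4) *
          ((max ‖x‖ t)⁻¹ ^ 4 * (1 - Real.log t) ^ (-β)))]
    have h2 : ∀ t : ℝ, t ^ 3 * (1 / (16 * Real.pi ^ 4) *
          ((max ‖x‖ t)⁻¹ ^ 4 * (1 - Real.log t) ^ (-β))) = 1 / (16 * Real.pi ^ 4) *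
          (t ^ 3 * ((max ‖x‖ t)⁻¹ ^ 4 * (1 - Real.log t) ^ (-β))) := fun t => by ring
    simp only [h2]
    rw [integral_const_mul]
    have h3 := integral_kernel_le hβ hβ1 hn hn1
    rw [← logInv_eq hx0] at h3
    calc _ ≤ 2 * Real.pi ^ 2 * (1 / (16 * Real.pi ^ 4) * (logInv x ^ (1 - β) / (1 - β))) := by
          gcongr
      _ = _ := by field_simp; norm_num
  have h4 : (radialConst β * psi β x) ^ 2 =
      1 / (8 * Real.pi ^ 2 * (1 - β)) * logInv x ^ (1 - β) := by
    rw [mul_pow, radialConst, Real.sq_sqrt (by positivity), psi, ← Real.rpow_mul_natCast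
      (by linarith)]
    congr 2; push_cast; ring
  rw [← h4] at hsq
  exact le_of_sq_le_sq hsq (mul_nonneg (Real.sqrt_nonneg _) (psi_nonneg hx hx0))

/-- The radial lemma. -/
lemma abs_evalG_le {β : ℝ} (hβ : 0 < β) (hβ1 : β < 1) (h : WL2 β) {x : R4} (hx : x ∈ B)
    (hx0 : x ≠ 0) : |evalG β h x| ≤ radialConst β * ‖h‖ * psi β x := by
  calc |evalG β h x| ≤ ‖evalVec β ‖x‖‖ * ‖h‖ := abs_real_inner_le_norm _ _
    _ ≤ radialConst β * psi β x * ‖h‖ := by gcongr; exact norm_evalVec_le hβ hβ1 hx hx0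
    _ = _ := by ring

lemma isRadial_evalG (β : ℝ) (h : WL2 β) : IsRadial (evalG β h) := fun x y hxy => by
  rw [evalG, evalG, hxy]

/-! ### Weak Laplacians and their limits. -/

instance : IsFiniteMeasure (volume.restrict B : Measure R4) :=
  ⟨by simpa [B] using measure_ball_lt_top⟩

lemma integrableOn_of_isWeak {u : R4 → ℝ} (hu : LocallyIntegrableOn u B) {ψ : R4 → ℝ}
    (hc : Continuous ψ) (hs : HasCompactSupport ψ) (hB : tsupport ψ ⊆ B) :
    IntegrableOn (fun x => u x * ψ x) B := by
  have h1 : IntegrableOn u (tsupport ψ) := hu.integrableOn_compact_subset hB hs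
  have h2 : IntegrableOn (fun x => u x * ψ x) (tsupport ψ) :=
    h1.mul_continuousOn hc.continuousOn hs
  have h3 : Integrable (fun x => u x * ψ x) volume := by
    rw [← integrableOn_iff_integrable_of_support_subset (s := tsupport ψ)]
    · exact h2
    · intro x hx
      exact subset_tsupport _ (right_ne_zero_of_mul hx)
  exact h3.integrableOn

/-- The fundamental lemma of the calculus of variations; it makes the choice in `lap` immaterial up
to null sets. -/
lemma IsWeakLaplacian.unique {u g g' : R4 → ℝ} (h : IsWeakLaplacian u g)
    (h' : IsWeakLaplacian u g') : g =ᵐ[volume.restrict B] g' := by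
  have h0 := Metric.isOpen_ball.ae_eq_zero_of_integral_contDiff_smul_eq_zero
    (U := B) (μ := volume) (f := fun x => g x - g' x) (h.2.1.sub h'.2.1) (by
      intro φ h1 h2 h3
      have hφ : IsTest φ := ⟨h1, h2, h3⟩
      have e1 := (h.2.2 φ hφ).symm.trans (h'.2.2 φ hφ)
      have e2 : ∫ x, φ x • (g x - g' x) = ∫ x in B, φ x • (g x - g' x) := by
        refine (setIntegral_eq_integral_of_forall_compl_eq_zero fun x hx => ?_).symm
        rw [image_eq_zero_of_notMem_tsupport fun hh => hx (h3 hh), zero_smul]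
      rw [e2]
      calc ∫ x in B, φ x • (g x - g' x) = ∫ x in B, (g x * φ x - g' x * φ x) := by
            congr 1; ext x; simp; ring
        _ = 0 := by
            rw [integral_sub (integrableOn_of_isWeak h.2.1 h1.continuous h2 h3)
              (integrableOn_of_isWeak h'.2.1 h1.continuous h2 h3), e1, sub_self])
  rw [Filter.EventuallyEq, ae_restrict_iff' measurableSet_B]
  filter_upwards [h0] with x hx hxB
  linarith [hx hxB]

lemma lap_ae_eq {u g : R4 → ℝ} (h : IsWeakLaplacian u g) : lap u =ᵐ[volume.restrict B] g := by
  have hex : ∃ g, IsWeakLaplacian u g := ⟨g, h⟩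
  rw [lap, dif_pos hex]
  exact hex.choose_spec.unique h

/-- A test function as a Schwartz function. -/
def IsTest.toSchwartz {φ : R4 → ℝ} (h : IsTest φ) : SchwartzMap R4 ℝ :=
  h.compact.toSchwartzMap h.smooth

lemma IsTest.coe_toSchwartz {φ : R4 → ℝ} (h : IsTest φ) : (h.toSchwartz : R4 → ℝ) = φ := rfl

lemma IsTest.laplacian_toSchwartz {φ : R4 → ℝ} (h : IsTest φ) (x : R4) :
    (Δ φ) x = (Δ h.toSchwartz) x := by
  rw [SchwartzMap.laplacian_apply, h.coe_toSchwartz]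

lemma IsTest.continuous_laplacian {φ : R4 → ℝ} (h : IsTest φ) : Continuous (Δ φ) := by
  rw [show Δ φ = ((Δ h.toSchwartz : SchwartzMap R4 ℝ) : R4 → ℝ) from
    funext h.laplacian_toSchwartz]
  exact SchwartzMap.continuous _

lemma IsTest.laplacian_eq_zero {φ : R4 → ℝ} {x : R4} (hx : x ∉ tsupport φ) : (Δ φ) x = 0 := by
  rw [(InnerProductSpace.laplacian_congr_nhds
    (notMem_tsupport_iff_eventuallyEq.1 hx)).eq_of_nhds]
  exact congrFun (InnerProductSpace.laplacian_const (c := (0 : ℝ))) x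

lemma IsTest.hasCompactSupport_laplacian {φ : R4 → ℝ} (h : IsTest φ) : HasCompactSupport (Δ φ) :=
  HasCompactSupport.intro h.compact fun _ hx => IsTest.laplacian_eq_zero hx

lemma IsTest.memLp_laplacian {φ : R4 → ℝ} (h : IsTest φ) (μ : Measure R4) [IsFiniteMeasure μ] :
    MemLp (Δ φ) 2 μ := by
  obtain ⟨C, hC⟩ := h.continuous_laplacian.bounded_above_of_compact_support
    h.hasCompactSupport_laplacian
  exact MemLp.of_bound h.continuous_laplacian.aestronglyMeasurable C (ae_of_all _ hC)

lemma IsTest.bounded {φ : R4 → ℝ} (h : IsTest φ) : ∃ C, ∀ x, ‖φ x‖ ≤ C :=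
  h.smooth.continuous.bounded_above_of_compact_support h.compact

lemma IsTest.memLp {φ : R4 → ℝ} (h : IsTest φ) (μ : Measure R4) [IsFiniteMeasure μ] :
    MemLp φ 2 μ := by
  obtain ⟨C, hC⟩ := h.bounded
  exact MemLp.of_bound h.smooth.continuous.aestronglyMeasurable C (ae_of_all _ hC)

/-- The supports lie in the ball, so the integrals extend to the whole space, where the Laplacian is
symmetric on Schwartz functions. -/
lemma IsTest.integral_mul_laplacian {φ ψ : R4 → ℝ} (h : IsTest φ) (h' : IsTest ψ) :
    ∫ x in B, φ x * (Δ ψ) x = ∫ x in B, (Δ φ) x * ψ x := by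
  rw [setIntegral_eq_integral_of_forall_compl_eq_zero fun x hx => ?_,
    setIntegral_eq_integral_of_forall_compl_eq_zero fun x hx => ?_]
  · have := SchwartzMap.integral_mul_laplacian_right_eq_left (μ := volume)
      h.toSchwartz h'.toSchwartz
    simpa only [← IsTest.laplacian_toSchwartz, IsTest.coe_toSchwartz] using this
  · rw [image_eq_zero_of_notMem_tsupport fun hh => hx (h'.supp hh), mul_zero]
  · rw [image_eq_zero_of_notMem_tsupport fun hh => hx (h.supp hh), zero_mul]

lemma tendsto_integral_mul_of_eLpNorm {μ : Measure R4} {f : ℕ → R4 → ℝ} {f₀ g : R4 → ℝ}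
    (hf : ∀ n, MemLp (f n) 2 μ) (hf₀ : MemLp f₀ 2 μ) (hg : MemLp g 2 μ)
    (h : Tendsto (fun n => eLpNorm (f n - f₀) 2 μ) atTop (𝓝 0)) :
    Tendsto (fun n => ∫ x, f n x * g x ∂μ) atTop (𝓝 (∫ x, f₀ x * g x ∂μ)) := by
  have key : ∀ {a : R4 → ℝ} (ha : MemLp a 2 μ),
      ∫ x, a x * g x ∂μ = inner ℝ (ha.toLp a) (hg.toLp g) := by
    intro a ha
    rw [L2.inner_def]
    refine integral_congr_ae ?_
    filter_upwards [ha.coeFn_toLp, hg.coeFn_toLp] with x h1 h2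
    rw [h1, h2]; simp [mul_comm]
  simp only [fun n => key (hf n), key hf₀]
  exact ((Lp.tendsto_Lp_iff_tendsto_eLpNorm'' f hf f₀ hf₀).2 h).inner tendsto_const_nhds

lemma locallyIntegrableOn_of_memLp {u : R4 → ℝ} (h : MemLp u 2 (volume.restrict B)) :
    LocallyIntegrableOn u B :=
  IntegrableOn.locallyIntegrableOn (h.integrable (by norm_num))

/-- Weak Laplacians pass to the limit in `L²(B)`. -/
lemma isWeakLaplacian_of_tendsto {φ : ℕ → R4 → ℝ} {u g : R4 → ℝ} (hφ : ∀ n, IsTest (φ n))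
    (hu : MemLp u 2 (volume.restrict B)) (hg : MemLp g 2 (volume.restrict B))
    (h1 : Tendsto (fun n => eLpNorm (φ n - u) 2 (volume.restrict B)) atTop (𝓝 0))
    (h2 : Tendsto (fun n => eLpNorm (Δ (φ n) - g) 2 (volume.restrict B)) atTop (𝓝 0)) :
    IsWeakLaplacian u g := by
  refine ⟨locallyIntegrableOn_of_memLp hu, locallyIntegrableOn_of_memLp hg, fun ψ hψ => ?_⟩
  have e1 := tendsto_integral_mul_of_eLpNorm (fun n => (hφ n).memLp _) hu
    (hψ.memLp_laplacian _) h1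
  have e2 := tendsto_integral_mul_of_eLpNorm (fun n => (hφ n).memLp_laplacian _) hg
    (hψ.memLp _) h2
  simp only [(hφ _).integral_mul_laplacian hψ] at e1
  exact tendsto_nhds_unique e1 e2

lemma IsTest.add {φ ψ : R4 → ℝ} (h : IsTest φ) (h' : IsTest ψ) : IsTest (φ + ψ) :=
  ⟨h.smooth.add h'.smooth, h.compact.add h'.compact,
    (tsupport_add φ ψ).trans (union_subset h.supp h'.supp)⟩

lemma IsTest.smul {φ : R4 → ℝ} (h : IsTest φ) (c : ℝ) : IsTest (c • φ) :=
  ⟨h.smooth.const_smul c, h.compact.smul_left (f := fun _ => c),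
    (tsupport_smul_subset_right (fun _ => c) φ).trans h.supp⟩

/-! ### The space `𝐄` as a closed subspace of `L²(B, w)`. -/

/-- The Laplacians of radial test functions. -/
def testLaplacians (β : ℝ) : Submodule ℝ (WL2 β) where
  carrier := {h | ∃ φ, IsTest φ ∧ IsRadial φ ∧ h =ᵐ[weightedMeasure β] Δ φ}
  add_mem' := by
    rintro a b ⟨φ, h1, h2, h3⟩ ⟨ψ, k1, k2, k3⟩
    refine ⟨φ + ψ, h1.add k1, fun x y hxy => by simp [h2 x y hxy, k2 x y hxy], ?_⟩
    filter_upwards [Lp.coeFn_add a b, h3, k3] with x e1 e2 e3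
    rw [e1, Pi.add_apply, e2, e3, ContDiffAt.laplacian_add
      ((h1.smooth.of_le (by norm_cast)).contDiffAt)
      ((k1.smooth.of_le (by norm_cast)).contDiffAt)]
  zero_mem' := ⟨0, ⟨contDiff_const, HasCompactSupport.zero, by simp⟩, fun _ _ _ => rfl, by
    filter_upwards [Lp.coeFn_zero ℝ 2 (weightedMeasure β)] with x hx
    rw [hx]
    exact (congrFun (InnerProductSpace.laplacian_const (c := (0 : ℝ))) x).symm⟩
  smul_mem' := by
    rintro c a ⟨φ, h1, h2, h3⟩
    refine ⟨c • φ, h1.smul c, fun x y hxy => by simp [h2 x y hxy], ?_⟩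
    filter_upwards [Lp.coeFn_smul c a, h3] with x e1 e2
    rw [e1, Pi.smul_apply, e2, InnerProductSpace.laplacian_smul c
      ((h1.smooth.of_le (by norm_cast)).contDiffAt)]

/-- The Hilbert space of the Laplacians of elements of `𝐄`. -/
def lapSpace (β : ℝ) : Submodule ℝ (WL2 β) := (testLaplacians β).topologicalClosure

lemma memLp_psi {β : ℝ} (hβ1 : β < 1) : MemLp (psi β) 2 (volume.restrict B) := by
  rw [memLp_two_iff_integrable_sq (measurable_psi β).aestronglyMeasurable]
  have h := integrableOn_logInv_rpow_mul_exp (k := 1 - β) (q := 0) (by linarith) (by norm_num)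
  refine Integrable.congr h ?_
  filter_upwards [ae_mem_B_ne_zero] with x ⟨hx, hx0⟩
  have := one_le_logInv hx hx0
  rw [psi, ← Real.rpow_mul_natCast (by linarith)]
  simp

lemma evalG_add (β : ℝ) (h k : WL2 β) (x : R4) :
    evalG β (h + k) x = evalG β h x + evalG β k x := inner_add_right _ _ _

lemma evalG_sub (β : ℝ) (h k : WL2 β) (x : R4) :
    evalG β (h - k) x = evalG β h x - evalG β k x := inner_sub_right _ _ _

lemma evalG_smul (β c : ℝ) (h : WL2 β) (x : R4) :
    evalG β (c • h) x = c * evalG β h x := inner_smul_right _ _ _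

lemma continuous_evalG (β : ℝ) (x : R4) : Continuous fun h : WL2 β => evalG β h x :=
  continuous_const.inner continuous_id

lemma exists_seq_of_mem_lapSpace {β : ℝ} {h : WL2 β} (hh : h ∈ lapSpace β) :
    ∃ (φ : ℕ → R4 → ℝ) (k : ℕ → WL2 β), (∀ n, IsTest (φ n) ∧ IsRadial (φ n)) ∧
      (∀ n, k n =ᵐ[weightedMeasure β] Δ (φ n)) ∧ Tendsto k atTop (𝓝 h) := by
  obtain ⟨k, hk, hk'⟩ := mem_closure_iff_seq_limit.1 hh
  choose φ h1 h2 h3 using hk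
  exact ⟨φ, k, fun n => ⟨h1 n, h2 n⟩, h3, hk'⟩

lemma aestronglyMeasurable_evalG {β : ℝ} (hβ : 0 < β) {h : WL2 β} (hh : h ∈ lapSpace β) :
    AEStronglyMeasurable (evalG β h) (volume.restrict B) := by
  obtain ⟨φ, k, hφ, hk, hlim⟩ := exists_seq_of_mem_lapSpace hh
  refine aestronglyMeasurable_of_tendsto_ae atTop
    (fun n => (hφ n).1.smooth.continuous.aestronglyMeasurable) ?_
  filter_upwards [ae_mem_B_ne_zero] with x ⟨hx, hx0⟩
  simp only [← evalG_laplacian hβ (hφ _).1 (hφ _).2 (hk _) hx hx0]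
  exact ((continuous_evalG β x).tendsto h).comp hlim

lemma memLp_evalG {β : ℝ} (hβ : 0 < β) (hβ1 : β < 1) {h : WL2 β} (hh : h ∈ lapSpace β) :
    MemLp (evalG β h) 2 (volume.restrict B) := by
  refine MemLp.of_le_mul (c := radialConst β * ‖h‖) (memLp_psi hβ1)
    (aestronglyMeasurable_evalG hβ hh) ?_
  filter_upwards [ae_mem_B_ne_zero] with x ⟨hx, hx0⟩
  rw [Real.norm_of_nonneg (psi_nonneg hx hx0)]
  exact abs_evalG_le hβ hβ1 h hx hx0

lemma eLpNorm_evalG_le {β : ℝ} (hβ : 0 < β) (hβ1 : β < 1) (h : WL2 β) :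
    eLpNorm (evalG β h) 2 (volume.restrict B) ≤
      ENNReal.ofReal (radialConst β * ‖h‖) * eLpNorm (psi β) 2 (volume.restrict B) := by
  refine eLpNorm_le_mul_eLpNorm_of_ae_le_mul ?_ 2
  filter_upwards [ae_mem_B_ne_zero] with x ⟨hx, hx0⟩
  rw [Real.norm_of_nonneg (psi_nonneg hx hx0)]
  exact abs_evalG_le hβ hβ1 h hx hx0

/-- Every element of the Hilbert space `lapSpace` is the Laplacian of an element of `𝐄`. -/
theorem mem_E_of_ae_eq_evalG {β : ℝ} (hβ : 0 < β) (hβ1 : β < 1) {h : WL2 β} (hh : h ∈ lapSpace β)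
    {u : R4 → ℝ} (hu : u =ᵐ[volume.restrict B] evalG β h) :
    u ∈ E β ∧ lap u =ᵐ[weightedMeasure β] h := by
  obtain ⟨φ, k, hφ, hk, hlim⟩ := exists_seq_of_mem_lapSpace hh
  have hfin := isFiniteMeasure_weightedMeasure hβ
  have hle := restrict_le_weightedMeasure hβ
  -- By the radial lemma, convergence of the Laplacians forces that of the functions, because `psi`
  -- is square integrable.
  have hφu : Tendsto (fun n => eLpNorm (u - φ n) 2 (volume.restrict B)) atTop (𝓝 0) := by
    have e1 : ∀ n, eLpNorm (u - φ n) 2 (volume.restrict B) =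
        eLpNorm (evalG β (h - k n)) 2 (volume.restrict B) := fun n => by
      refine eLpNorm_congr_ae ?_
      filter_upwards [hu, ae_mem_B_ne_zero] with x hx ⟨hxB, hx0⟩
      rw [Pi.sub_apply, hx, evalG_sub, evalG_laplacian hβ (hφ n).1 (hφ n).2 (hk n) hxB hx0]
    simp only [e1]
    have e2 : Tendsto (fun n => ENNReal.ofReal (radialConst β * ‖h - k n‖) *
        eLpNorm (psi β) 2 (volume.restrict B)) atTop (𝓝 0) := by
      have e3 : Tendsto (fun n => radialConst β * ‖h - k n‖) atTop (𝓝 0) := by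
        simpa using (((tendsto_const_nhds (x := h)).sub hlim).norm).const_mul (radialConst β)
      have e4 := ENNReal.Tendsto.mul_const (b := eLpNorm (psi β) 2 (volume.restrict B))
        (ENNReal.tendsto_ofReal e3) (Or.inr (memLp_psi hβ1).2.ne)
      simpa using e4
    exact tendsto_of_tendsto_of_tendsto_of_le_of_le tendsto_const_nhds e2
      (fun _ => zero_le) fun n => eLpNorm_evalG_le hβ hβ1 _
  have hlap : ∀ {g : R4 → ℝ}, g =ᵐ[weightedMeasure β] h →
      Tendsto (fun n => eLpNorm (g - Δ (φ n)) 2 (weightedMeasure β)) atTop (𝓝 0) := by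
    intro g hg
    have e1 := (Lp.tendsto_Lp_iff_tendsto_eLpNorm' k h).1 hlim
    refine e1.congr fun n => ?_
    rw [eLpNorm_sub_comm]
    refine eLpNorm_congr_ae ?_
    filter_upwards [hg, hk n] with x h1 h2
    simp [h1, h2]
  have humem : MemLp u 2 (volume.restrict B) := (memLp_evalG hβ hβ1 hh).ae_eq hu.symm
  have hweak : IsWeakLaplacian u h := by
    refine isWeakLaplacian_of_tendsto (fun n => (hφ n).1) humem ((Lp.memLp h).mono_measure hle)
      ?_ ?_
    · simpa only [eLpNorm_sub_comm] using hφu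
    · refine tendsto_of_tendsto_of_tendsto_of_le_of_le tendsto_const_nhds
        (hlap EventuallyEq.rfl) (fun _ => zero_le) fun n => ?_
      rw [eLpNorm_sub_comm]
      exact eLpNorm_mono_measure _ hle
  have hl : lap u =ᵐ[weightedMeasure β] h := (ae_weightedMeasure_iff hβ).2 (lap_ae_eq hweak)
  exact ⟨⟨humem, ⟨_, hweak⟩, (Lp.memLp h).ae_eq hl.symm, φ, hφ, hφu, hlap hl⟩, hl⟩

/-- Every element of `𝐄` is represented by its Laplacian. -/
theorem exists_mem_lapSpace {β : ℝ} (hβ : 0 < β) {u : R4 → ℝ} (hu : u ∈ E β) :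
    ∃ h ∈ lapSpace β, u =ᵐ[volume.restrict B] evalG β h := by
  obtain ⟨hu2, -, hlap, φ, hφ, h1, h2⟩ := hu
  have hfin := isFiniteMeasure_weightedMeasure hβ
  set k : ℕ → WL2 β := fun n => ((hφ n).1.memLp_laplacian (weightedMeasure β)).toLp with hk
  have hlim : Tendsto k atTop (𝓝 (hlap.toLp (lap u))) := by
    rw [hk, Lp.tendsto_Lp_iff_tendsto_eLpNorm'']
    simpa only [eLpNorm_sub_comm] using h2
  refine ⟨hlap.toLp (lap u), ?_, ?_⟩
  · refine mem_closure_of_tendsto hlim (Eventually.of_forall fun n => ?_)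
    exact ⟨φ n, (hφ n).1, (hφ n).2, MemLp.coeFn_toLp _⟩
  -- Along a subsequence the test functions tend to `u` almost everywhere; by continuity of
  -- evaluations they also tend to `evalG` of the limit Laplacian.
  · have hm : TendstoInMeasure (volume.restrict B) φ atTop u :=
      tendstoInMeasure_of_tendsto_eLpNorm (p := 2) (by norm_num)
        (fun n => (hφ n).1.smooth.continuous.aestronglyMeasurable) hu2.1
        (by simpa only [eLpNorm_sub_comm] using h1)
    obtain ⟨ns, hns, hae⟩ := hm.exists_seq_tendsto_ae
    filter_upwards [hae, ae_mem_B_ne_zero] with x hx ⟨hxB, hx0⟩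
    have e1 : Tendsto (fun i => evalG β (k (ns i)) x) atTop (𝓝 (evalG β (hlap.toLp (lap u)) x)) :=
      ((continuous_evalG β x).tendsto _).comp (hlim.comp hns.tendsto_atTop)
    have e2 : ∀ i, evalG β (k (ns i)) x = φ (ns i) x := fun i =>
      evalG_laplacian hβ (hφ _).1 (hφ _).2 (MemLp.coeFn_toLp _) hxB hx0
    simp only [e2] at e1
    exact tendsto_nhds_unique hx e1

lemma ip_eq_inner {β : ℝ} (hβ : 0 < β) {u v : R4 → ℝ} {h k : WL2 β}
    (hu : lap u =ᵐ[weightedMeasure β] h) (hv : lap v =ᵐ[weightedMeasure β] k) :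
    ip β u v = inner ℝ h k := by
  rw [L2.inner_def, integral_weightedMeasure hβ, ip]
  refine integral_congr_ae ?_
  filter_upwards [(ae_weightedMeasure_iff hβ).1 hu, (ae_weightedMeasure_iff hβ).1 hv] with x h1 h2
  rw [h1, h2]
  simp
  ring

/-- Evaluation is injective since `h` is recovered as the weak Laplacian of the function it
represents. -/
lemma eq_zero_of_evalG_ae_eq_zero {β : ℝ} (hβ : 0 < β) (hβ1 : β < 1) {h : WL2 β}
    (hh : h ∈ lapSpace β) (h0 : evalG β h =ᵐ[volume.restrict B] 0) : h = 0 := by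
  have e1 := (mem_E_of_ae_eq_evalG hβ hβ1 hh (u := 0) h0.symm).2
  have e2 := (mem_E_of_ae_eq_evalG hβ hβ1 (Submodule.zero_mem _) (h := 0) (u := 0)
    (by filter_upwards with x; simp [evalG])).2
  exact Lp.ext (e1.symm.trans e2)

/-- The values of an element of `𝐄` at the origin are of lower order than `psi`. -/
lemma abs_evalG_le_add {β : ℝ} (hβ : 0 < β) (hβ1 : β < 1) {h : WL2 β} (hh : h ∈ lapSpace β)
    {ε : ℝ} (hε : 0 < ε) :
    ∃ K, 0 ≤ K ∧ ∀ x ∈ B, x ≠ 0 → |evalG β h x| ≤ K + ε * psi β x := by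
  obtain ⟨φ, k, hφ, hk, hlim⟩ := exists_seq_of_mem_lapSpace hh
  have e3 : Tendsto (fun n => radialConst β * ‖h - k n‖) atTop (𝓝 0) := by
    simpa using (((tendsto_const_nhds (x := h)).sub hlim).norm).const_mul (radialConst β)
  -- A test function close enough in norm is bounded, which gives `K`; the radial lemma makes the
  -- remainder at most `ε * psi`.
  obtain ⟨n, hn⟩ := (e3.eventually_lt_const hε).exists
  obtain ⟨C, hC⟩ := (hφ n).1.bounded
  refine ⟨C, (norm_nonneg _).trans (hC 0), fun x hx hx0 => ?_⟩
  have h1 : evalG β h x = φ n x + evalG β (h - k n) x := by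
    rw [evalG_sub, evalG_laplacian hβ (hφ n).1 (hφ n).2 (hk n) hx hx0]; ring
  have h2 := abs_evalG_le hβ hβ1 (h - k n) hx hx0
  have h3 := psi_nonneg (β := β) hx hx0
  rw [h1]
  calc |φ n x + evalG β (h - k n) x| ≤ |φ n x| + |evalG β (h - k n) x| := abs_add_le _ _
    _ ≤ C + ε * psi β x := add_le_add (hC x)
        (h2.trans (mul_le_mul_of_nonneg_right hn.le h3))

/-- Needed so that the set defining `mp` is not empty. The witness is a radial bump supported in the
ball of radius `1/2`, tested at a point of norm `1/4`. -/
lemma exists_ne_zero_mem_lapSpace {β : ℝ} (hβ : 0 < β) : ∃ h ∈ lapSpace β, h ≠ 0 := by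
  set φ : R4 → ℝ := fun x => Real.smoothTransition (1 - 4 * ‖x‖ ^ 2) with hφd
  have hsm : ContDiff ℝ ∞ φ := by
    refine Real.smoothTransition.contDiff.comp ?_
    exact contDiff_const.sub (contDiff_const.mul (contDiff_norm_sq ℝ))
  have hsupp : Function.support φ ⊆ Metric.closedBall 0 (1 / 2) := by
    intro x hx
    by_contra hh
    refine hx (Real.smoothTransition.zero_of_nonpos ?_)
    have : 1 / 2 < ‖x‖ := by simpa using hh
    nlinarith
  have hts : tsupport φ ⊆ Metric.closedBall 0 (1 / 2) :=
    closure_minimal hsupp Metric.isClosed_closedBall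
  have hφ : IsTest φ := ⟨hsm, HasCompactSupport.of_support_subset_isCompact
    (isCompact_closedBall _ _) hsupp,
    hts.trans (Metric.closedBall_subset_ball (by norm_num))⟩
  have hr : IsRadial φ := fun x y hxy => by simp [hφd, hxy]
  have hfin := isFiniteMeasure_weightedMeasure hβ
  have hk := (hφ.memLp_laplacian (weightedMeasure β)).coeFn_toLp
  refine ⟨(hφ.memLp_laplacian (weightedMeasure β)).toLp, Submodule.le_topologicalClosure _
    ⟨φ, hφ, hr, hk⟩, fun h0 => ?_⟩
  set x : R4 := EuclideanSpace.single 0 (1 / 4) with hx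
  have hxn : ‖x‖ = 1 / 4 := by simp [hx]
  have hxB : x ∈ B := by simp [B, hxn]; norm_num
  have hx0 : x ≠ 0 := by rw [← norm_ne_zero_iff, hxn]; norm_num
  have h1 := evalG_laplacian hβ hφ hr hk hxB hx0
  rw [h0] at h1
  have h2 : 0 < φ x := Real.smoothTransition.pos_of_pos (by rw [hxn]; norm_num)
  rw [← h1] at h2
  simp [evalG] at h2

/-! ### Pointwise properties of the nonlinearity. -/

/-- The hypotheses on the nonlinearity, with the critical growth condition replaced by the bound
`|f(x, t)| ≤ C |t| exp (α |t| ^ γ)`. -/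
structure IsNonlinearity (β α C θ p Cp : ℝ) (f : R4 → ℝ → ℝ) : Prop where
  cont : ContinuousOn (fun z : R4 × ℝ => f z.1 z.2) (B ×ˢ univ)
  α_pos : 0 < α
  C_nonneg : 0 ≤ C
  growth : ∀ x ∈ B, ∀ t, |f x t| ≤ C * |t| * Real.exp (α * |t| ^ gammaExp β)
  two_lt : 2 < θ
  ar : ∀ x ∈ B, ∀ t : ℝ, t ≠ 0 →
      0 < θ * primitive f x t ∧ θ * primitive f x t ≤ t * f x t
  mono : ∀ x ∈ B, StrictMonoOn (fun t : ℝ => f x t / |t|) {t | t ≠ 0}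
  origin : ∀ x ∈ B, Tendsto (fun t : ℝ => |f x t| / |t|) (𝓝[≠] 0) (𝓝 0)
  lt_p : θ < p
  one_lt : 1 < Cp
  lower : ∀ x ∈ B, ∀ t : ℝ, Cp * |t| ^ (p - 1) ≤ Real.sign t * f x t

lemma gammaExp_pos {β : ℝ} (hβ1 : β < 1) : 0 < gammaExp β := div_pos two_pos (by linarith)

lemma continuous_section {f : R4 → ℝ → ℝ}
    (h : ContinuousOn (fun z : R4 × ℝ => f z.1 z.2) (B ×ˢ univ)) {x : R4} (hx : x ∈ B) :
    Continuous (f x) := by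
  have : ContinuousOn (fun t : ℝ => f x t) univ :=
    h.comp (f := fun t : ℝ => (x, t)) (by fun_prop) fun t _ => ⟨hx, mem_univ _⟩
  exact continuousOn_univ.1 this

/-- The critical growth condition and the monotonicity of `f(x, t) / |t|` give a bound for `f`. -/
lemma exists_growth_bound {β α₀ α : ℝ} {f : R4 → ℝ → ℝ} (hα : α₀ < α)
    (hα0 : 0 < α)
    (hcrit : HasCriticalGrowth β α₀ f)
    (hV1 : ContinuousOn (fun z : R4 × ℝ => f z.1 z.2) (B ×ˢ univ))
    (hpos : ∀ x ∈ B, ∀ t : ℝ, t ≠ 0 → 0 < t * f x t)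
    (hV3 : ∀ x ∈ B, StrictMonoOn (fun t : ℝ => f x t / |t|) {t | t ≠ 0})
    (hV4 : ∀ x ∈ B, Tendsto (fun t : ℝ => |f x t| / |t|) (𝓝[≠] 0) (𝓝 0)) :
    ∃ C, 0 ≤ C ∧ ∀ x ∈ B, ∀ t, |f x t| ≤ C * |t| * Real.exp (α * |t| ^ gammaExp β) := by
  have hev := Metric.tendstoUniformlyOn_iff.1 (hcrit.upper α hα) 1 one_pos
  rw [eventually_sup] at hev
  obtain ⟨⟨a, ha⟩, b, hb⟩ := hev.imp eventually_atBot.1 eventually_atTop.1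
  set s := max 1 (max (-a) b) with hs
  have hs1 : 1 ≤ s := le_max_left _ _
  have hsa : -s ≤ a := by
    have : -a ≤ s := (le_max_left _ _).trans (le_max_right _ _)
    linarith
  have hsb : b ≤ s := (le_max_right _ _).trans (le_max_right _ _)
  have hlarge : ∀ x ∈ B, ∀ t, s ≤ |t| → |f x t| ≤ Real.exp (α * |t| ^ gammaExp β) := by
    intro x hx t ht
    have h1 : dist (0 : ℝ) (|f x t| / Real.exp (α * |t| ^ gammaExp β)) < 1 := by
      rcases le_abs.1 ht with h | h
      · exact hb t (hsb.trans h) x hx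
      · exact ha t (by linarith) x hx
    rw [dist_comm, Real.dist_0_eq_abs, abs_div, abs_abs, Real.abs_exp,
      div_lt_one (Real.exp_pos _)] at h1
    exact h1.le
  -- For `|t| ≥ s ≥ 1` critical growth suffices. For `0 < |t| < s`, monotonicity bounds
  -- `|f(x,t)|/|t|` by its value at `s` or `-s`, uniformly in `x`.
  refine ⟨Real.exp (α * s ^ gammaExp β), (Real.exp_pos _).le, fun x hx t => ?_⟩
  have hs0 : 0 < s := by linarith
  have hE1 : 1 ≤ Real.exp (α * s ^ gammaExp β) := Real.one_le_exp (by positivity)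
  have hE2 : 1 ≤ Real.exp (α * |t| ^ gammaExp β) := Real.one_le_exp (by positivity)
  rcases le_or_gt s |t| with h | h
  · calc |f x t| ≤ 1 * 1 * Real.exp (α * |t| ^ gammaExp β) := by
          rw [one_mul, one_mul]; exact hlarge x hx t h
      _ ≤ _ := by gcongr; exact hs1.trans h
  · have key : ∀ v : ℝ, |v| = s → |f x v| / |v| ≤ Real.exp (α * s ^ gammaExp β) := by
      intro v hv
      rw [hv]
      refine (div_le_self (abs_nonneg _) hs1).trans ?_
      have := hlarge x hx v hv.ge
      rwa [hv] at this
    rcases lt_trichotomy t 0 with ht | ht | ht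
    · have h1 := hV3 x hx (show -s ∈ {t : ℝ | t ≠ 0} by simpa using hs0.ne') ht.ne
        (by rw [abs_of_neg ht] at h; linarith)
      have h2 := key (-s) (by rw [abs_neg, abs_of_pos hs0])
      have e1 : f x t < 0 := by nlinarith [hpos x hx t ht.ne]
      have e2 : f x (-s) < 0 := by nlinarith [hpos x hx (-s) (by linarith)]
      have h3 : |f x t| / |t| ≤ Real.exp (α * s ^ gammaExp β) := by
        refine le_trans ?_ h2
        rw [abs_of_neg e1, abs_of_neg e2, neg_div, neg_div]
        exact neg_le_neg h1.le
      rw [div_le_iff₀ (by simpa using ht.ne)] at h3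
      exact h3.trans (le_mul_of_one_le_right (by positivity) hE2)
    -- Here the claim is `f(x,0) = 0`, which follows from `(V₄)` and continuity.
    · subst ht
      have hc : Tendsto (fun t => |f x t|) (𝓝[≠] 0) (𝓝 |f x 0|) :=
        ((continuous_section hV1 hx).abs.tendsto 0).mono_left nhdsWithin_le_nhds
      have hc' : Tendsto (fun t : ℝ => |f x t| / |t| * |t|) (𝓝[≠] 0) (𝓝 (0 * |(0 : ℝ)|)) :=
        (hV4 x hx).mul ((continuous_abs.tendsto 0).mono_left nhdsWithin_le_nhds)
      have h0 : |f x 0| = 0 := by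
        rw [zero_mul] at hc'
        refine tendsto_nhds_unique hc (hc'.congr' ?_)
        filter_upwards [self_mem_nhdsWithin] with t ht
        exact div_mul_cancel₀ _ (abs_ne_zero.2 ht)
      rw [h0]; simp
    · have h1 := hV3 x hx ht.ne' (show s ∈ {t : ℝ | t ≠ 0} from hs0.ne')
        (by rw [abs_of_pos ht] at h; linarith)
      have h2 := key s (abs_of_pos hs0)
      have e1 : 0 < f x t := by nlinarith [hpos x hx t ht.ne']
      have e2 : 0 < f x s := by nlinarith [hpos x hx s hs0.ne']
      have h3 : |f x t| / |t| ≤ Real.exp (α * s ^ gammaExp β) := by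
        refine le_trans ?_ h2
        rw [abs_of_pos e1, abs_of_pos e2]
        exact h1.le
      rw [div_le_iff₀ (by simpa using ht.ne')] at h3
      exact h3.trans (le_mul_of_one_le_right (by positivity) hE2)

/-- Continuity is known only over the ball, so `g` is first extended by zero to a measurable
function of both variables. -/
lemma aestronglyMeasurable_comp {g : R4 → ℝ → ℝ}
    (h : ContinuousOn (fun z : R4 × ℝ => g z.1 z.2) (B ×ˢ univ)) {u : R4 → ℝ}
    (hu : AEStronglyMeasurable u (volume.restrict B)) :
    AEStronglyMeasurable (fun x => g x (u x)) (volume.restrict B) := by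
  have hS : MeasurableSet (B ×ˢ (univ : Set ℝ)) := measurableSet_B.prod MeasurableSet.univ
  have h1 : Measurable ((B ×ˢ (univ : Set ℝ)).indicator fun z : R4 × ℝ => g z.1 z.2) := by
    classical
    rw [← piecewise_eq_indicator]
    exact h.measurable_piecewise continuousOn_const hS
  obtain ⟨v, hv, huv⟩ := hu
  refine AEStronglyMeasurable.congr (f := fun x =>
    (B ×ˢ (univ : Set ℝ)).indicator (fun z : R4 × ℝ => g z.1 z.2) (x, v x))
    (h1.comp (measurable_id.prodMk hv.measurable)).aestronglyMeasurable ?_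
  filter_upwards [huv, ae_restrict_mem measurableSet_B] with x hx hxB
  rw [hx, indicator_of_mem (by simpa using hxB)]

lemma continuousOn_primitive {f : R4 → ℝ → ℝ}
    (h : ContinuousOn (fun z : R4 × ℝ => f z.1 z.2) (B ×ˢ univ)) :
    ContinuousOn (fun z : R4 × ℝ => primitive f z.1 z.2) (B ×ˢ univ) := by
  have h1 : Continuous (fun q : (B × ℝ) × ℝ => f q.1.1 q.2) :=
    h.comp_continuous (f := fun q : (B × ℝ) × ℝ => ((q.1.1 : R4), q.2)) (by fun_prop)
      fun q => ⟨q.1.1.2, mem_univ _⟩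
  have h2 : Continuous (fun q : B × ℝ => primitive f q.1 q.2) :=
    intervalIntegral.continuous_parametric_intervalIntegral_of_continuous
      (f := fun (q : B × ℝ) t => f q.1 t) h1 continuous_snd
  rw [continuousOn_iff_continuous_domRestrict]
  exact h2.comp (f := fun z : (B ×ˢ (univ : Set ℝ) : Set (R4 × ℝ)) =>
    ((⟨z.1.1, z.2.1⟩ : B), z.1.2)) (by fun_prop)

namespace IsNonlinearity

variable {β α C θ p Cp : ℝ} {f : R4 → ℝ → ℝ} (hf : IsNonlinearity β α C θ p Cp f)
include hf

lemma continuous {x : R4} (hx : x ∈ B) : Continuous (f x) := continuous_section hf.cont hx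

lemma zero {x : R4} (hx : x ∈ B) : f x 0 = 0 := by
  have := hf.growth x hx 0
  simpa using this

lemma hasDerivAt_primitive {x : R4} (hx : x ∈ B) (t : ℝ) :
    HasDerivAt (primitive f x) (f x t) t :=
  ((hf.continuous hx).integral_hasStrictDerivAt 0 t).hasDerivAt

lemma primitive_nonneg {x : R4} (hx : x ∈ B) (t : ℝ) : 0 ≤ primitive f x t := by
  rcases eq_or_ne t 0 with rfl | ht
  · simp [primitive]
  · have := (hf.ar x hx t ht).1
    have h2 := hf.two_lt
    exact (pos_of_mul_pos_right this (by linarith)).le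

lemma theta_mul_primitive_le {x : R4} (hx : x ∈ B) (t : ℝ) :
    θ * primitive f x t ≤ f x t * t := by
  rcases eq_or_ne t 0 with rfl | ht
  · simp [primitive]
  · linarith [(hf.ar x hx t ht).2]

lemma mul_self_nonneg {x : R4} (hx : x ∈ B) (t : ℝ) : 0 ≤ f x t * t := by
  have h2 := hf.two_lt
  have := hf.theta_mul_primitive_le hx t
  have := mul_nonneg (show 0 ≤ θ by linarith) (hf.primitive_nonneg hx t)
  linarith

lemma abs_primitive_le {x : R4} (hx : x ∈ B) (t : ℝ) : |primitive f x t| ≤ |f x t * t| := by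
  rw [abs_of_nonneg (hf.primitive_nonneg hx t), abs_of_nonneg (hf.mul_self_nonneg hx t)]
  have h2 := hf.two_lt
  nlinarith [hf.theta_mul_primitive_le hx t, hf.primitive_nonneg hx t]

/-- The ray inequality for the nonlinearity. -/
lemma mul_lt_of_lt_one {x : R4} (hx : x ∈ B) {s t : ℝ} (hs : s ≠ 0) (ht : 0 < t) (ht1 : t < 1) :
    f x (t * s) * s < t * (f x s * s) := by
  rcases hs.lt_or_gt with h | h
  · have h1 := hf.mono x hx (a := s) (b := t * s) hs (mul_ne_zero ht.ne' hs) (by nlinarith)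
    have hts : t * s < 0 := mul_neg_of_pos_of_neg ht h
    simp only [abs_of_neg h, abs_of_neg hts] at h1
    rw [div_lt_div_iff₀ (by linarith) (by linarith)] at h1
    nlinarith
  · have h1 := hf.mono x hx (a := t * s) (b := s) (mul_ne_zero ht.ne' hs) hs (by nlinarith)
    have hts : 0 < t * s := mul_pos ht h
    simp only [abs_of_pos h, abs_of_pos hts] at h1
    rw [div_lt_div_iff₀ (by linarith) (by linarith)] at h1
    nlinarith

lemma mul_gt_of_one_lt {x : R4} (hx : x ∈ B) {s t : ℝ} (hs : s ≠ 0) (ht : 1 < t) :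
    t * (f x s * s) < f x (t * s) * s := by
  have ht0 : 0 < t := by linarith
  have h := hf.mul_lt_of_lt_one hx (s := t * s) (t := t⁻¹) (mul_ne_zero ht0.ne' hs)
    (inv_pos.2 ht0) (inv_lt_one_of_one_lt₀ ht)
  rw [inv_mul_cancel_left₀ ht0.ne'] at h
  have e : t⁻¹ * (f x (t * s) * (t * s)) = f x (t * s) * s := by field_simp
  rw [e] at h
  linarith

/-- The function `D(τ) = F(x, τs) - τ² f(x,s)s / 2` has derivative `f(x,τs)s - τ f(x,s)s`, which is
negative for `0 < τ < 1` and positive for `τ > 1` when `s ≠ 0`, so `D` is minimal at `1`.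
Integrated, this controls the energy along rays without differentiating `f`. -/
lemma primitive_ray {x : R4} (hx : x ∈ B) (s : ℝ) {t : ℝ} (ht : 0 ≤ t) :
    primitive f x s + (t ^ 2 - 1) / 2 * (f x s * s) ≤ primitive f x (t * s) := by
  rcases eq_or_ne s 0 with rfl | hs
  · simp
  set D : ℝ → ℝ := fun τ => primitive f x (τ * s) - τ ^ 2 / 2 * (f x s * s) with hD
  have hd : ∀ τ, HasDerivAt D (f x (τ * s) * s - τ * (f x s * s)) τ := by
    intro τ
    have h1 := (hf.hasDerivAt_primitive hx (τ * s)).comp τ (hasDerivAt_mul_const s)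
    have h2 := ((hasDerivAt_pow 2 τ).div_const 2).mul_const (f x s * s)
    refine (h1.sub h2).congr_deriv ?_
    norm_num
  have hc : Continuous D := continuous_iff_continuousAt.2 fun τ => (hd τ).continuousAt
  have key : D 1 ≤ D t := by
    rcases le_total t 1 with h | h
    · refine antitoneOn_of_deriv_nonpos (convex_Icc 0 1) hc.continuousOn
        (fun τ _ => (hd τ).differentiableAt.differentiableWithinAt) (fun τ hτ => ?_)
        ⟨ht, h⟩ ⟨zero_le_one, le_rfl⟩ h
      rw [interior_Icc] at hτ
      rw [(hd τ).deriv]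
      linarith [hf.mul_lt_of_lt_one hx hs hτ.1 hτ.2]
    · refine monotoneOn_of_deriv_nonneg (convex_Ici 1) hc.continuousOn
        (fun τ _ => (hd τ).differentiableAt.differentiableWithinAt) (fun τ hτ => ?_)
        self_mem_Ici h h
      rw [interior_Ici] at hτ
      rw [(hd τ).deriv]
      linarith [hf.mul_gt_of_one_lt hx hs hτ]
  simp only [hD, one_mul] at key
  linarith

lemma lower_mul_self {x : R4} (hx : x ∈ B) (t : ℝ) : Cp * |t| ^ p ≤ f x t * t := by
  have h := hf.lower x hx t
  have hp : 0 < p := by linarith [hf.lt_p, hf.two_lt]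
  rcases eq_or_ne t 0 with rfl | ht
  · simp [Real.zero_rpow hp.ne']
  · have e : |t| ^ p = |t| ^ (p - 1) * |t| := by
      rw [← Real.rpow_add_one (abs_ne_zero.2 ht)]; congr 1; ring
    have e2 : Real.sign t * f x t * |t| = f x t * t := by
      rcases ht.lt_or_gt with h | h
      · rw [Real.sign_of_neg h, abs_of_neg h]; ring
      · rw [Real.sign_of_pos h, abs_of_pos h]; ring
    rw [e, ← mul_assoc, ← e2]
    exact mul_le_mul_of_nonneg_right h (abs_nonneg t)

/-- The primitive dominates `Cp |t| ^ p / p`. -/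
lemma lower_primitive {x : R4} (hx : x ∈ B) (t : ℝ) : Cp * |t| ^ p / p ≤ primitive f x t := by
  have hp : 0 < p := by linarith [hf.lt_p, hf.two_lt]
  set D : ℝ → ℝ := fun τ => primitive f x (τ * t) - τ ^ p * (Cp * |t| ^ p / p) with hD
  have hd : ∀ τ ∈ Ioo (0 : ℝ) 1, HasDerivAt D
      (f x (τ * t) * t - p * τ ^ (p - 1) * (Cp * |t| ^ p / p)) τ := by
    intro τ hτ
    have h1 := (hf.hasDerivAt_primitive hx (τ * t)).comp τ (hasDerivAt_mul_const t)
    exact h1.sub ((Real.hasDerivAt_rpow_const (Or.inl hτ.1.ne')).mul_const _)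
  have hc : Continuous D := by
    have h1 : Continuous (primitive f x) :=
      continuous_iff_continuousAt.2 fun τ => (hf.hasDerivAt_primitive hx τ).continuousAt
    exact (h1.comp (continuous_mul_const t)).sub
      ((Real.continuous_rpow_const hp.le).mul continuous_const)
  have key : D 0 ≤ D 1 := by
    -- The lower bound on `f` is integrated along the segment from `0` to `t`.
    refine monotoneOn_of_deriv_nonneg (convex_Icc 0 1) hc.continuousOn ?_ (fun τ hτ => ?_)
      ⟨le_rfl, zero_le_one⟩ ⟨zero_le_one, le_rfl⟩ zero_le_one
    · rw [interior_Icc]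
      exact fun τ hτ => (hd τ hτ).differentiableAt.differentiableWithinAt
    rw [interior_Icc] at hτ
    rw [(hd τ hτ).deriv]
    have h2 := hf.lower_mul_self hx (τ * t)
    rw [abs_mul, abs_of_pos hτ.1, Real.mul_rpow hτ.1.le (abs_nonneg t)] at h2
    have e : τ ^ p = τ ^ (p - 1) * τ := by
      rw [← Real.rpow_add_one hτ.1.ne']; congr 1; ring
    have e3 : p * τ ^ (p - 1) * (Cp * |t| ^ p / p) = Cp * (τ ^ (p - 1) * |t| ^ p) := by
      field_simp
    rw [e3]
    rw [e] at h2
    have h3 : 0 ≤ τ * (f x (τ * t) * t - Cp * (τ ^ (p - 1) * |t| ^ p)) := by nlinarith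
    exact nonneg_of_mul_nonneg_right h3 hτ.1
  simp only [hD, zero_mul, Real.zero_rpow hp.ne', one_mul, Real.one_rpow, sub_zero] at key
  have h0 : primitive f x 0 = 0 := by simp [primitive]
  linarith

lemma abs_le_of_abs_le (hβ1 : β < 1) {x : R4} (hx : x ∈ B) {t a : ℝ} (h : |t| ≤ a) :
    |f x t| ≤ C * (a * Real.exp (α * a ^ gammaExp β)) := by
  have h1 := hf.C_nonneg
  have h2 := hf.α_pos
  have h3 := gammaExp_pos hβ1
  have ha : 0 ≤ a := (abs_nonneg t).trans h
  calc |f x t| ≤ C * |t| * Real.exp (α * |t| ^ gammaExp β) := hf.growth x hx t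
    _ = C * (|t| * Real.exp (α * |t| ^ gammaExp β)) := by ring
    _ ≤ _ := by gcongr

/-- Monotonicity of the quotient `f(x, t) / t`. -/
lemma mul_self_le {x : R4} (hx : x ∈ B) {s b : ℝ} (hb : 0 < b) (h : |s| ≤ b) :
    f x s * s ≤ s ^ 2 * (|f x b| / |b| + |f x (-b)| / |-b|) := by
  rcases lt_trichotomy s 0 with hs | rfl | hs
  · rw [abs_of_neg hs] at h
    have h1 := (hf.mono x hx).monotoneOn (a := -b) (b := s) (by simpa using hb.ne') hs.ne
      (by linarith)
    simp only [abs_neg, abs_of_pos hb, abs_of_neg hs] at h1 ⊢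
    have h2 : -f x s ≤ -s * (|f x (-b)| / b) := by
      rw [div_le_div_iff₀ hb (by linarith)] at h1
      rw [mul_div_assoc', le_div_iff₀ hb]
      nlinarith [neg_abs_le (f x (-b))]
    have h3 : 0 ≤ |f x b| / b := by positivity
    nlinarith [mul_nonneg (sq_nonneg s) h3, mul_le_mul_of_nonneg_left h2 (neg_pos.2 hs).le]
  · simp
  · rw [abs_of_pos hs] at h
    have h1 := (hf.mono x hx).monotoneOn (a := s) (b := b) hs.ne' hb.ne' h
    simp only [abs_neg, abs_of_pos hb, abs_of_pos hs] at h1 ⊢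
    have h2 : f x s ≤ s * (|f x b| / b) := by
      rw [div_le_div_iff₀ hs hb] at h1
      rw [mul_div_assoc', le_div_iff₀ hb]
      nlinarith [le_abs_self (f x b)]
    have h3 : 0 ≤ |f x (-b)| / b := by positivity
    nlinarith [mul_nonneg (sq_nonneg s) h3, mul_le_mul_of_nonneg_left h2 hs.le]

end IsNonlinearity

/-! ### Integrable majorants and dominated convergence. -/

/-- The Hilbert space of the Laplacians of elements of `𝐄`, as a type. -/
abbrev LapHilbert (β : ℝ) := lapSpace β

/-- The element of `𝐄` with a given Laplacian. -/
def ev {β : ℝ} (h : LapHilbert β) (x : R4) : ℝ := evalG β (h : WL2 β) x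

instance (β : ℝ) : CompleteSpace (LapHilbert β) :=
  (Submodule.isClosed_topologicalClosure _).completeSpace_coe

@[simp] lemma ev_add {β : ℝ} (h k : LapHilbert β) (x : R4) : ev (h + k) x = ev h x + ev k x :=
  evalG_add _ _ _ _

@[simp] lemma ev_smul {β : ℝ} (c : ℝ) (h : LapHilbert β) (x : R4) : ev (c • h) x = c * ev h x :=
  evalG_smul _ _ _ _

@[simp] lemma ev_zero {β : ℝ} (x : R4) : ev (0 : LapHilbert β) x = 0 := by
  simp [ev, evalG]

@[simp] lemma ev_neg {β : ℝ} (h : LapHilbert β) (x : R4) : ev (-h) x = -ev h x := by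
  simp [ev, evalG]

lemma aestronglyMeasurable_ev {β : ℝ} (hβ : 0 < β) (h : LapHilbert β) :
    AEStronglyMeasurable (ev h) (volume.restrict B) := aestronglyMeasurable_evalG hβ h.2

lemma abs_ev_le {β : ℝ} (hβ : 0 < β) (hβ1 : β < 1) (h : LapHilbert β) {x : R4} (hx : x ∈ B)
    (hx0 : x ≠ 0) : |ev h x| ≤ radialConst β * ‖h‖ * psi β x := abs_evalG_le hβ hβ1 _ hx hx0

/-- Functions whose exponential growth is integrable on the ball. -/
structure Dominant (β α : ℝ) (a : R4 → ℝ) : Prop where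
  nonneg : ∀ x ∈ B, x ≠ 0 → 0 ≤ a x
  integrable : IntegrableOn (fun x => a x * (a x * Real.exp (α * a x ^ gammaExp β))) B

lemma psi_le_logInv {β : ℝ} (hβ : 0 < β) {x : R4} (hx : x ∈ B) (hx0 : x ≠ 0) :
    psi β x ≤ logInv x := by
  have h := one_le_logInv hx hx0
  calc psi β x ≤ logInv x ^ (1 : ℝ) := Real.rpow_le_rpow_of_exponent_le h (by linarith)
    _ = _ := Real.rpow_one _

/-- Since `psi^γ = logInv`, the exponential is a multiple of `|x|^(-α m^γ)`, and `4` is the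
dimension. This majorant serves a whole ball of `𝐄`. -/
lemma dominant_mul_psi {β α m : ℝ} (hβ : 0 < β) (hβ1 : β < 1) (hm : 0 ≤ m)
    (h : α * m ^ gammaExp β < 4) : Dominant β α (fun x => m * psi β x) := by
  refine ⟨fun x hx hx0 => mul_nonneg hm (psi_nonneg hx hx0), ?_⟩
  have h1 := (integrableOn_logInv_rpow_mul_exp (k := 1 - β) (by linarith) h).const_mul (m ^ 2)
  refine Integrable.congr h1 ?_
  filter_upwards [ae_mem_B_ne_zero] with x ⟨hx, hx0⟩
  have hL := one_le_logInv hx hx0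
  have e1 : psi β x ^ 2 = logInv x ^ (1 - β) := by
    rw [psi, ← Real.rpow_mul_natCast (by linarith)]; simp
  rw [Real.mul_rpow hm (psi_nonneg hx hx0), psi_rpow_gammaExp hβ1 hx hx0, ← e1]
  ring_nf

/-- A sum is at most twice the larger term, so the constant contributes a bounded factor and only
`ε` enters the exponent at the origin. This majorant serves fixed elements of `𝐄`, whatever their
norm. -/
lemma dominant_const_add {β α K ε : ℝ} (hβ : 0 < β) (hβ1 : β < 1) (hα : 0 < α) (hK : 0 ≤ K)
    (hε : 0 ≤ ε) (h : α * (2 * ε) ^ gammaExp β < 4) :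
    Dominant β α (fun x => K + ε * psi β x) := by
  have hγ := gammaExp_pos hβ1
  refine ⟨fun x hx hx0 => add_nonneg hK (mul_nonneg hε (psi_nonneg hx hx0)), ?_⟩
  have h1 := (integrableOn_logInv_rpow_mul_exp (k := 2) (by norm_num) h).const_mul
    ((K + ε) ^ 2 * Real.exp (α * (2 * K) ^ gammaExp β))
  have hm := measurable_psi β
  refine Integrable.mono' h1 (Measurable.aestronglyMeasurable (by fun_prop)) ?_
  filter_upwards [ae_mem_B_ne_zero] with x ⟨hx, hx0⟩
  have hL := one_le_logInv hx hx0
  have hψ := psi_nonneg (β := β) hx hx0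
  have ha : 0 ≤ K + ε * psi β x := add_nonneg hK (mul_nonneg hε hψ)
  rw [Real.norm_of_nonneg (by positivity)]
  have e1 : K + ε * psi β x ≤ (K + ε) * logInv x := by
    have := mul_le_mul_of_nonneg_left (psi_le_logInv hβ hx hx0) hε
    nlinarith
  have e2 : (K + ε * psi β x) ^ gammaExp β ≤
      (2 * K) ^ gammaExp β + (2 * ε) ^ gammaExp β * logInv x := by
    rw [← psi_rpow_gammaExp hβ1 hx hx0, ← Real.mul_rpow (by positivity) hψ]
    rcases le_total K (ε * psi β x) with h' | h'
    · calc (K + ε * psi β x) ^ gammaExp β ≤ (2 * ε * psi β x) ^ gammaExp β :=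
            Real.rpow_le_rpow ha (by linarith) hγ.le
        _ ≤ _ := le_add_of_nonneg_left (by positivity)
    · calc (K + ε * psi β x) ^ gammaExp β ≤ (2 * K) ^ gammaExp β :=
            Real.rpow_le_rpow ha (by linarith) hγ.le
        _ ≤ _ := le_add_of_nonneg_right (by positivity)
  calc (K + ε * psi β x) * ((K + ε * psi β x) * Real.exp (α * (K + ε * psi β x) ^ gammaExp β))
      ≤ ((K + ε) * logInv x) * (((K + ε) * logInv x) *
        Real.exp (α * ((2 * K) ^ gammaExp β + (2 * ε) ^ gammaExp β * logInv x))) := by gcongr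
    _ = (K + ε) ^ 2 * Real.exp (α * (2 * K) ^ gammaExp β) *
        (logInv x ^ (2 : ℝ) * Real.exp (α * (2 * ε) ^ gammaExp β * logInv x)) := by
      rw [mul_add, Real.exp_add, Real.rpow_two, ← mul_assoc α]
      ring

/-- Elements of `𝐄` are exponentially integrable to all orders. -/
lemma exists_dominant {β α : ℝ} (hβ : 0 < β) (hβ1 : β < 1) (hα : 0 < α) (u φ χ : LapHilbert β)
    {R : ℝ} (hR : 0 ≤ R) :
    ∃ a, Dominant β α a ∧ ∀ x ∈ B, x ≠ 0 → R * (|ev u x| + |ev φ x|) + |ev χ x| ≤ a x := by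
  have hγ := gammaExp_pos hβ1
  -- Chosen so that `α (2ε')^γ = 2 < 4`; below, `ε'` is shared out as `R(ε + ε) + ε` among the three
  -- functions.
  set ε' := (1 / 2) * (2 / α) ^ (1 / gammaExp β) with hε'
  have hε'0 : 0 < ε' := by positivity
  have hlt : α * (2 * ε') ^ gammaExp β < 4 := by
    have : 2 * ε' = (2 / α) ^ (1 / gammaExp β) := by rw [hε']; ring
    rw [this, ← Real.rpow_mul (by positivity), one_div_mul_cancel hγ.ne', Real.rpow_one]
    rw [mul_div_cancel₀ _ hα.ne']; norm_num
  set ε := ε' / (2 * R + 1) with hε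
  have hε0 : 0 < ε := by positivity
  obtain ⟨K1, hK1, h1⟩ := abs_evalG_le_add hβ hβ1 u.2 hε0
  obtain ⟨K2, hK2, h2⟩ := abs_evalG_le_add hβ hβ1 φ.2 hε0
  obtain ⟨K3, hK3, h3⟩ := abs_evalG_le_add hβ hβ1 χ.2 hε0
  refine ⟨_, dominant_const_add (K := R * (K1 + K2) + K3) hβ hβ1 hα (by positivity) hε'0.le hlt,
    fun x hx hx0 => ?_⟩
  have e : ε' = R * (ε + ε) + ε := by rw [hε]; field_simp; ring
  calc R * (|ev u x| + |ev φ x|) + |ev χ x|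
      ≤ R * ((K1 + ε * psi β x) + (K2 + ε * psi β x)) + (K3 + ε * psi β x) := by
        gcongr
        · exact h1 x hx hx0
        · exact h2 x hx hx0
        · exact h3 x hx hx0
    _ = _ := by rw [e]; ring

namespace IsNonlinearity

variable {β α C θ p Cp : ℝ} {f : R4 → ℝ → ℝ} (hf : IsNonlinearity β α C θ p Cp f)
include hf

lemma abs_mul_le_dominant (hβ1 : β < 1) {a : R4 → ℝ}
    {x : R4} (hx : x ∈ B) {t s : ℝ} (ht : |t| ≤ a x) (hs : |s| ≤ a x) :
    |f x t * s| ≤ C * (a x * (a x * Real.exp (α * a x ^ gammaExp β))) := by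
  rw [abs_mul]
  have h1 := hf.abs_le_of_abs_le hβ1 hx ht
  have h2 := hf.C_nonneg
  have h3 : 0 ≤ a x := (abs_nonneg _).trans ht
  calc |f x t| * |s| ≤ C * (a x * Real.exp (α * a x ^ gammaExp β)) * a x := by gcongr
    _ = _ := by ring

lemma integrable_mul (hβ1 : β < 1) {a v χ : R4 → ℝ} (ha : Dominant β α a)
    (hv : AEStronglyMeasurable v (volume.restrict B))
    (hχ : AEStronglyMeasurable χ (volume.restrict B))
    (hva : ∀ x ∈ B, x ≠ 0 → |v x| ≤ a x) (hχa : ∀ x ∈ B, x ≠ 0 → |χ x| ≤ a x) :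
    IntegrableOn (fun x => f x (v x) * χ x) B := by
  refine Integrable.mono' (ha.integrable.const_mul C)
    ((aestronglyMeasurable_comp hf.cont hv).mul hχ) ?_
  filter_upwards [ae_mem_B_ne_zero] with x ⟨hx, hx0⟩
  exact hf.abs_mul_le_dominant hβ1 hx (hva x hx hx0) (hχa x hx hx0)

lemma integrable_primitive (hβ1 : β < 1) {a v : R4 → ℝ} (ha : Dominant β α a)
    (hv : AEStronglyMeasurable v (volume.restrict B))
    (hva : ∀ x ∈ B, x ≠ 0 → |v x| ≤ a x) :
    IntegrableOn (fun x => primitive f x (v x)) B := by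
  refine Integrable.mono' (ha.integrable.const_mul C)
    (aestronglyMeasurable_comp (continuousOn_primitive hf.cont) hv) ?_
  filter_upwards [ae_mem_B_ne_zero] with x ⟨hx, hx0⟩
  exact (hf.abs_primitive_le hx _).trans
    (hf.abs_mul_le_dominant hβ1 hx (hva x hx hx0) (hva x hx hx0))

/-- Stated for a general filter, to cover both sequences and continuity in real parameters. -/
lemma tendsto_integral_mul (hβ1 : β < 1) {ι : Type*} {l : Filter ι} [l.IsCountablyGenerated]
    {a : R4 → ℝ} {v χ : ι → R4 → ℝ} {v₀ χ₀ : R4 → ℝ} (ha : Dominant β α a)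
    (hv : ∀ i, AEStronglyMeasurable (v i) (volume.restrict B))
    (hχ : ∀ i, AEStronglyMeasurable (χ i) (volume.restrict B))
    (hva : ∀ᶠ i in l, ∀ x ∈ B, x ≠ 0 → |v i x| ≤ a x ∧ |χ i x| ≤ a x)
    (hvl : ∀ x ∈ B, x ≠ 0 → Tendsto (fun i => v i x) l (𝓝 (v₀ x)))
    (hχl : ∀ x ∈ B, x ≠ 0 → Tendsto (fun i => χ i x) l (𝓝 (χ₀ x))) :
    Tendsto (fun i => ∫ x in B, f x (v i x) * χ i x) l (𝓝 (∫ x in B, f x (v₀ x) * χ₀ x)) := by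
  refine tendsto_integral_filter_of_dominated_convergence _ (Eventually.of_forall fun i =>
    (aestronglyMeasurable_comp hf.cont (hv i)).mul (hχ i)) ?_ (ha.integrable.const_mul C) ?_
  · filter_upwards [hva] with i hi
    filter_upwards [ae_mem_B_ne_zero] with x ⟨hx, hx0⟩
    exact hf.abs_mul_le_dominant hβ1 hx (hi x hx hx0).1 (hi x hx hx0).2
  · filter_upwards [ae_mem_B_ne_zero] with x ⟨hx, hx0⟩
    exact (((hf.continuous hx).tendsto _).comp (hvl x hx hx0)).mul (hχl x hx hx0)

lemma tendsto_integral_primitive (hβ1 : β < 1) {ι : Type*} {l : Filter ι}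
    [l.IsCountablyGenerated] {a : R4 → ℝ} {v : ι → R4 → ℝ} {v₀ : R4 → ℝ} (ha : Dominant β α a)
    (hv : ∀ i, AEStronglyMeasurable (v i) (volume.restrict B))
    (hva : ∀ᶠ i in l, ∀ x ∈ B, x ≠ 0 → |v i x| ≤ a x)
    (hvl : ∀ x ∈ B, x ≠ 0 → Tendsto (fun i => v i x) l (𝓝 (v₀ x))) :
    Tendsto (fun i => ∫ x in B, primitive f x (v i x)) l (𝓝 (∫ x in B, primitive f x (v₀ x))) := by
  refine tendsto_integral_filter_of_dominated_convergence _ (Eventually.of_forall fun i =>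
    aestronglyMeasurable_comp (continuousOn_primitive hf.cont) (hv i)) ?_
    (ha.integrable.const_mul C) ?_
  · filter_upwards [hva] with i hi
    filter_upwards [ae_mem_B_ne_zero] with x ⟨hx, hx0⟩
    exact (hf.abs_primitive_le hx _).trans
      (hf.abs_mul_le_dominant hβ1 hx (hi x hx hx0) (hi x hx hx0))
  · filter_upwards [ae_mem_B_ne_zero] with x ⟨hx, hx0⟩
    exact ((hf.hasDerivAt_primitive hx _).continuousAt.tendsto).comp (hvl x hx hx0)

lemma integrable_ev (hβ : 0 < β) (hβ1 : β < 1) (u χ : LapHilbert β) :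
    IntegrableOn (fun x => f x (ev u x) * ev χ x) B := by
  obtain ⟨a, ha, hle⟩ := exists_dominant hβ hβ1 hf.α_pos u 0 χ zero_le_one
  refine hf.integrable_mul hβ1 ha (aestronglyMeasurable_ev hβ u) (aestronglyMeasurable_ev hβ χ)
    (fun x hx hx0 => ?_) (fun x hx hx0 => ?_)
  all_goals
    have h := hle x hx hx0
    rw [ev_zero, abs_zero, add_zero, one_mul] at h
    linarith [abs_nonneg (ev u x), abs_nonneg (ev χ x)]

lemma integrable_primitive_ev (hβ : 0 < β) (hβ1 : β < 1) (u : LapHilbert β) :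
    IntegrableOn (fun x => primitive f x (ev u x)) B := by
  obtain ⟨a, ha, hle⟩ := exists_dominant hβ hβ1 hf.α_pos 0 0 u zero_le_one
  refine hf.integrable_primitive hβ1 ha (aestronglyMeasurable_ev hβ u) (fun x hx hx0 => ?_)
  simpa using hle x hx hx0

/-- The derivative of the nonlinear part is continuous on finite-dimensional subspaces. -/
lemma continuous_integral_mul (hβ : 0 < β) (hβ1 : β < 1) (u φ χ : LapHilbert β) :
    Continuous fun q : ℝ × ℝ => ∫ x in B, f x (ev (q.1 • u + q.2 • φ) x) * ev χ x := by
  rw [continuous_iff_continuousAt]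
  rintro ⟨a₀, b₀⟩
  set R := |a₀| + |b₀| + 1 with hR
  obtain ⟨a, ha, hle⟩ := exists_dominant hβ hβ1 hf.α_pos u φ χ (show 0 ≤ R by positivity)
  refine hf.tendsto_integral_mul hβ1 ha (fun q => aestronglyMeasurable_ev hβ _)
    (fun q => aestronglyMeasurable_ev hβ χ) ?_ (fun x _ _ => ?_) (fun x _ _ => tendsto_const_nhds)
  · have h1 : ∀ᶠ q : ℝ × ℝ in 𝓝 (a₀, b₀), |q.1| < R :=
      (continuous_fst.abs.tendsto (a₀, b₀)).eventually_lt_const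
        (by simp only [hR]; linarith [abs_nonneg b₀])
    have h2 : ∀ᶠ q : ℝ × ℝ in 𝓝 (a₀, b₀), |q.2| < R :=
      (continuous_snd.abs.tendsto (a₀, b₀)).eventually_lt_const
        (by simp only [hR]; linarith [abs_nonneg a₀])
    filter_upwards [h1, h2] with q hq1 hq2 x hx hx0
    have h3 := hle x hx hx0
    have h4 : |ev (q.1 • u + q.2 • φ) x| ≤ R * (|ev u x| + |ev φ x|) := by
      simp only [ev_add, ev_smul]
      refine (abs_add_le _ _).trans ?_
      rw [abs_mul, abs_mul, mul_add]
      gcongr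
    have h5 : 0 ≤ R * (|ev u x| + |ev φ x|) := by positivity
    exact ⟨by linarith [abs_nonneg (ev χ x)], by linarith⟩
  · have : Continuous fun q : ℝ × ℝ => ev (q.1 • u + q.2 • φ) x := by
      simp only [ev_add, ev_smul]; fun_prop
    exact this.tendsto _

/-- The nonlinear part of the energy is differentiable along lines. -/
lemma hasDerivAt_integral_primitive (hβ : 0 < β) (hβ1 : β < 1) (u φ : LapHilbert β) (b₀ : ℝ) :
    HasDerivAt (fun b : ℝ => ∫ x in B, primitive f x (ev (u + b • φ) x))
      (∫ x in B, f x (ev (u + b₀ • φ) x) * ev φ x) b₀ := by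
  set R := |b₀| + 1 with hR
  obtain ⟨a, ha, hle⟩ := exists_dominant hβ hβ1 hf.α_pos u φ φ (show 0 ≤ R by positivity)
  refine (hasDerivAt_integral_of_dominated_loc_of_deriv_le (s := Metric.ball b₀ 1)
    (F := fun b x => primitive f x (ev (u + b • φ) x))
    (F' := fun b x => f x (ev (u + b • φ) x) * ev φ x)
    (bound := fun x => C * (a x * (a x * Real.exp (α * a x ^ gammaExp β))))
    (Metric.ball_mem_nhds b₀ one_pos)
    (Eventually.of_forall fun b => (hf.integrable_primitive_ev hβ hβ1 _).1)
    (hf.integrable_primitive_ev hβ hβ1 _) (hf.integrable_ev hβ hβ1 _ _).1 ?_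
    (ha.integrable.const_mul C) ?_).2
  · filter_upwards [ae_mem_B_ne_zero] with x ⟨hx, hx0⟩ b hb
    have h3 := hle x hx hx0
    have hbR : |b| ≤ R := by
      have : |b - b₀| < 1 := by simpa [Real.dist_eq] using hb
      have := abs_sub_abs_le_abs_sub b b₀
      linarith
    have h4 : |ev (u + b • φ) x| ≤ R * (|ev u x| + |ev φ x|) := by
      simp only [ev_add, ev_smul]
      refine (abs_add_le _ _).trans ?_
      rw [abs_mul, mul_add]
      have : |ev u x| ≤ R * |ev u x| :=
        le_mul_of_one_le_left (abs_nonneg _) (by simp [hR])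
      gcongr
    have h5 : 0 ≤ R * (|ev u x| + |ev φ x|) := by positivity
    exact hf.abs_mul_le_dominant hβ1 hx (by linarith [abs_nonneg (ev φ x)]) (by linarith)
  · filter_upwards [ae_mem_B_ne_zero] with x ⟨hx, hx0⟩ b _
    have h1 : HasDerivAt (fun b : ℝ => ev (u + b • φ) x) (ev φ x) b := by
      simp only [ev_add, ev_smul]
      simpa using ((hasDerivAt_id b).mul_const (ev φ x)).const_add (ev u x)
    exact (hf.hasDerivAt_primitive hx _).comp b h1

end IsNonlinearity

/-! ### Weak convergence, the energy and its derivative. -/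

instance (β : ℝ) : SFinite (weightedMeasure β) := by
  unfold weightedMeasure; infer_instance

lemma separableSpace_lapHilbert (β : ℝ) : TopologicalSpace.SeparableSpace (LapHilbert β) := by
  have : Fact ((2 : ENNReal) ≠ ⊤) := ⟨by norm_num⟩
  have : SecondCountableTopology (WL2 β) := Lp.SecondCountableTopology
  have : SecondCountableTopology (LapHilbert β) :=
    TopologicalSpace.Subtype.secondCountableTopology _
  infer_instance

/-- Bounded sequences in a separable Hilbert space have weakly convergent subsequences. -/
lemma exists_weakly_convergent_subseq {H : Type*} [NormedAddCommGroup H] [InnerProductSpace ℝ H]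
    [CompleteSpace H] [TopologicalSpace.SeparableSpace H] {h : ℕ → H} {M : ℝ}
    (hM : ∀ n, ‖h n‖ ≤ M) :
    ∃ (u : H) (ns : ℕ → ℕ), StrictMono ns ∧
      ∀ k, Tendsto (fun n => inner ℝ (h (ns n)) k) atTop (𝓝 (inner ℝ u k)) := by
  obtain ⟨g, -, ns, hns, hg⟩ := WeakDual.isSeqCompact_closedBall ℝ H 0 M
    (x := fun n => StrongDual.toWeakDual (InnerProductSpace.toDual ℝ H (h n))) (fun n => by
      have : InnerProductSpace.toDual ℝ H (h n) ∈ Metric.closedBall (0 : StrongDual ℝ H) M := by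
        simpa using hM n
      exact this)
  refine ⟨(InnerProductSpace.toDual ℝ H).symm (WeakDual.toStrongDual g), ns, hns, fun k => ?_⟩
  rw [InnerProductSpace.toDual_symm_apply]
  exact (tendsto_iff_forall_eval_tendsto_topDualPairing.1 hg) k

/-- Weak convergence implies pointwise convergence. -/
lemma tendsto_ev_of_weak {β : ℝ} {h : ℕ → LapHilbert β} {u : LapHilbert β}
    (hu : ∀ k, Tendsto (fun n => inner ℝ (h n) k) atTop (𝓝 (inner ℝ u k))) (x : R4) :
    Tendsto (fun n => ev (h n) x) atTop (𝓝 (ev u x)) := by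
  -- Evaluation at `x` is a bounded functional, hence by Riesz a scalar product with a fixed vector.
  set L : StrongDual ℝ (LapHilbert β) :=
    (innerSL ℝ (evalVec β ‖x‖)).comp (lapSpace β).subtypeL with hL
  have key : ∀ k : LapHilbert β,
      ev k x = inner ℝ k ((InnerProductSpace.toDual ℝ (LapHilbert β)).symm L) := by
    intro k
    rw [real_inner_comm, InnerProductSpace.toDual_symm_apply]
    rfl
  simp only [key]
  exact hu _

lemma not_ev_ae_eq_zero {β : ℝ} (hβ : 0 < β) (hβ1 : β < 1) {h : LapHilbert β} (hh : h ≠ 0) :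
    ¬ ev h =ᵐ[volume.restrict B] 0 := fun h0 =>
  hh (Subtype.ext (eq_zero_of_evalG_ae_eq_zero hβ hβ1 h.2 h0))

/-- If the integral vanished, so would `g`, and with it `ev h`, almost everywhere. Pointwise strict
inequalities thus survive integration. -/
lemma integral_pos_of_ne_zero {β : ℝ} (hβ : 0 < β) (hβ1 : β < 1) {h : LapHilbert β} (hh : h ≠ 0)
    {g : R4 → ℝ} (hg : IntegrableOn g B) (h0 : ∀ x ∈ B, 0 ≤ g x)
    (hpos : ∀ x ∈ B, ev h x ≠ 0 → 0 < g x) : 0 < ∫ x in B, g x := by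
  have hae : 0 ≤ᵐ[volume.restrict B] g := by
    filter_upwards [ae_restrict_mem measurableSet_B] with x hx using h0 x hx
  refine lt_of_le_of_ne (integral_nonneg_of_ae hae) fun he => ?_
  have h1 := (integral_eq_zero_iff_of_nonneg_ae hae hg).1 he.symm
  refine not_ev_ae_eq_zero hβ hβ1 hh ?_
  filter_upwards [h1, ae_restrict_mem measurableSet_B] with x hx hxB
  by_contra hne
  exact (hpos x hxB hne).ne' hx

lemma radialConst_pos {β : ℝ} (hβ1 : β < 1) : 0 < radialConst β := by
  have : 0 < 1 - β := by linarith
  exact Real.sqrt_pos.2 (by positivity)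

lemma psi_pos {β : ℝ} {x : R4} (hx : x ∈ B) (hx0 : x ≠ 0) : 0 < psi β x :=
  Real.rpow_pos_of_pos (zero_lt_one.trans_le (one_le_logInv hx hx0)) _

/-- The energy as a function of the Laplacian. -/
def energy {β : ℝ} (f : R4 → ℝ → ℝ) (h : LapHilbert β) : ℝ :=
  1 / 2 * ‖h‖ ^ 2 - ∫ x in B, primitive f x (ev h x)

/-- The derivative of the energy. -/
def dEnergy {β : ℝ} (f : R4 → ℝ → ℝ) (h k : LapHilbert β) : ℝ :=
  inner ℝ h k - ∫ x in B, f x (ev h x) * ev k x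

/-- The Nehari set, in terms of Laplacians. -/
def lapNehari (β : ℝ) (f : R4 → ℝ → ℝ) : Set (LapHilbert β) := {h | h ≠ 0 ∧ dEnergy f h h = 0}

lemma norm_sq_of_mem_lapNehari {β : ℝ} {f : R4 → ℝ → ℝ} {h : LapHilbert β}
    (hh : h ∈ lapNehari β f) : ‖h‖ ^ 2 = ∫ x in B, f x (ev h x) * ev h x := by
  have := hh.2
  rw [dEnergy, real_inner_self_eq_norm_sq] at this
  linarith

lemma dEnergy_smul_right {β : ℝ} {f : R4 → ℝ → ℝ} (h k : LapHilbert β) (t : ℝ) :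
    dEnergy f h (t • k) = t * dEnergy f h k := by
  have e : inner ℝ h (t • k) = t * inner ℝ h k := real_inner_smul_right h k t
  unfold dEnergy
  rw [e, mul_sub, ← integral_const_mul]
  congr 2
  ext x
  rw [ev_smul]; ring

lemma integral_abs_rpow_smul {β p : ℝ} (h : LapHilbert β) {t : ℝ} (ht : 0 ≤ t) :
    ∫ x in B, |ev (t • h) x| ^ p = t ^ p * ∫ x in B, |ev h x| ^ p := by
  rw [← integral_const_mul]
  congr 1; ext x
  rw [ev_smul, abs_mul, Real.mul_rpow (abs_nonneg _) (abs_nonneg _), abs_of_nonneg ht]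

/-! ### The geometry of the Nehari set. -/

namespace IsNonlinearity

variable {β α C θ p Cp : ℝ} {f : R4 → ℝ → ℝ} (hf : IsNonlinearity β α C θ p Cp f)
include hf

/-- For small elements of `𝐄` the nonlinear term is smaller than the quadratic one. -/
lemma exists_radius (hβ : 0 < β) (hβ1 : β < 1) :
    ∃ ρ, 0 < ρ ∧ ∀ h : LapHilbert β, h ≠ 0 → ‖h‖ ≤ ρ →
      ∫ x in B, f x (ev h x) * ev h x < ‖h‖ ^ 2 := by
  have hγ := gammaExp_pos hβ1
  have hα := hf.α_pos
  have hC := hf.C_nonneg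
  set m := radialConst β with hm
  have hm0 : 0 < m := radialConst_pos hβ1
  -- Makes `α (ρ₀ m)^γ = 2`, so the ball of radius `ρ₀` is subcritical.
  set ρ₀ := (2 / α) ^ (1 / gammaExp β) / m with hρ₀
  have hρ₀0 : 0 < ρ₀ := by positivity
  have hlt : α * (ρ₀ * m) ^ gammaExp β < 4 := by
    rw [hρ₀, div_mul_cancel₀ _ hm0.ne', ← Real.rpow_mul (by positivity),
      one_div_mul_cancel hγ.ne', Real.rpow_one, mul_div_cancel₀ _ hα.ne']
    norm_num
  have hdom := dominant_mul_psi hβ hβ1 (by positivity) hlt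
  set q : ℝ → R4 → ℝ := fun b x => |f x b| / |b| + |f x (-b)| / |-b| with hq
  have hqb : ∀ x ∈ B, ∀ b, q b x ≤ 2 * C * Real.exp (α * |b| ^ gammaExp β) := by
    intro x hx b
    have : ∀ b : ℝ, |f x b| / |b| ≤ C * Real.exp (α * |b| ^ gammaExp β) := fun b =>
      div_le_of_le_mul₀ (abs_nonneg _) (by positivity)
        ((hf.growth x hx b).trans_eq (by ring))
    have h1 := this b
    have h2 := this (-b)
    rw [abs_neg] at h2
    simp only [hq, abs_neg]
    linarith
  have hq0 : ∀ b x, 0 ≤ q b x := fun b x => by positivity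
  -- On the ball of radius `ρ` the radial lemma and `mul_self_le` give `f(x,u)u ≤ ‖u‖² I ρ x`. Since
  -- `(V₄)` is not uniform in `x`, the integral of `I ρ` is shown to tend to `0` by dominated
  -- convergence.
  set I : ℝ → R4 → ℝ := fun ρ x => (m * psi β x) ^ 2 * q (ρ * (m * psi β x)) x with hI
  have hmeas : ∀ ρ, AEStronglyMeasurable (I ρ) (volume.restrict B) := by
    intro ρ
    have h1 : Measurable fun x => ρ * (m * psi β x) :=
      ((measurable_psi β).const_mul m).const_mul ρ
    have h2 := (aestronglyMeasurable_comp hf.cont h1.aestronglyMeasurable).norm.aemeasurable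
    have h3 := (aestronglyMeasurable_comp hf.cont h1.neg.aestronglyMeasurable).norm.aemeasurable
    have h4 := ((measurable_psi β).const_mul m).pow_const 2
    exact (h4.aemeasurable.mul ((h2.div h1.norm.aemeasurable).add
      (h3.div h1.neg.norm.aemeasurable))).aestronglyMeasurable
  have hbound : ∀ ρ, 0 < ρ → ρ ≤ ρ₀ → ∀ x ∈ B, x ≠ 0 → ‖I ρ x‖ ≤ 2 * C / ρ₀ ^ 2 *
      (ρ₀ * m * psi β x * (ρ₀ * m * psi β x *
        Real.exp (α * (ρ₀ * m * psi β x) ^ gammaExp β))) := by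
    intro ρ hρ hρ' x hx hx0
    have hψ := psi_pos (β := β) hx hx0
    rw [Real.norm_of_nonneg (mul_nonneg (sq_nonneg _) (hq0 _ _))]
    have h1 := hqb x hx (ρ * (m * psi β x))
    rw [abs_of_pos (by positivity)] at h1
    calc I ρ x ≤ (m * psi β x) ^ 2 *
          (2 * C * Real.exp (α * (ρ₀ * m * psi β x) ^ gammaExp β)) := by
          refine mul_le_mul_of_nonneg_left (h1.trans ?_) (sq_nonneg _)
          rw [mul_assoc ρ₀]
          gcongr
      _ = _ := by field_simp
  have hlim : Tendsto (fun ρ => ∫ x in B, I ρ x) (𝓝[>] 0) (𝓝 (∫ x in B, (0 : ℝ))) := by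
    refine tendsto_integral_filter_of_dominated_convergence _ (Eventually.of_forall hmeas) ?_
      (hdom.integrable.const_mul (2 * C / ρ₀ ^ 2)) ?_
    · filter_upwards [Ioc_mem_nhdsGT hρ₀0] with ρ hρ
      filter_upwards [ae_mem_B_ne_zero] with x ⟨hx, hx0⟩
      exact hbound ρ hρ.1 hρ.2 x hx hx0
    · filter_upwards [ae_mem_B_ne_zero] with x ⟨hx, hx0⟩
      have hψ := psi_pos (β := β) hx hx0
      have hb : Tendsto (fun ρ : ℝ => ρ * (m * psi β x)) (𝓝[>] 0) (𝓝[≠] 0) := by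
        refine tendsto_nhdsWithin_iff.2 ⟨?_, ?_⟩
        · have : Tendsto (fun ρ : ℝ => ρ * (m * psi β x)) (𝓝 0) (𝓝 (0 * (m * psi β x))) :=
            (continuous_mul_const _).tendsto 0
          rw [zero_mul] at this
          exact this.mono_left nhdsWithin_le_nhds
        · filter_upwards [self_mem_nhdsWithin] with ρ hρ
          have : (0 : ℝ) < ρ := hρ
          exact (mul_pos this (mul_pos hm0 hψ)).ne'
      have hb' : Tendsto (fun ρ : ℝ => -(ρ * (m * psi β x))) (𝓝[>] 0) (𝓝[≠] 0) := by
        refine tendsto_nhdsWithin_iff.2 ⟨?_, ?_⟩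
        · simpa using (tendsto_nhdsWithin_iff.1 hb).1.neg
        · filter_upwards [(tendsto_nhdsWithin_iff.1 hb).2] with ρ hρ
          exact neg_ne_zero.2 hρ
      have h1 := ((hf.origin x hx).comp hb).add ((hf.origin x hx).comp hb')
      have h2 := h1.const_mul ((m * psi β x) ^ 2)
      rw [add_zero, mul_zero] at h2
      exact h2
  rw [integral_zero] at hlim
  obtain ⟨ρ, h1, hρ⟩ := ((hlim.eventually_lt_const one_pos).and (Ioc_mem_nhdsGT hρ₀0)).exists
  refine ⟨ρ, hρ.1, fun h hh hn => ?_⟩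
  have hint : IntegrableOn (I ρ) B := by
    refine Integrable.mono' (hdom.integrable.const_mul (2 * C / ρ₀ ^ 2)) (hmeas ρ) ?_
    filter_upwards [ae_mem_B_ne_zero] with x ⟨hx, hx0⟩
    exact hbound ρ hρ.1 hρ.2 x hx hx0
  have hnn : 0 < ‖h‖ := norm_pos_iff.2 hh
  calc ∫ x in B, f x (ev h x) * ev h x ≤ ∫ x in B, ‖h‖ ^ 2 * I ρ x := by
        refine integral_mono_ae (hf.integrable_ev hβ hβ1 h h) (hint.const_mul _) ?_
        filter_upwards [ae_mem_B_ne_zero] with x ⟨hx, hx0⟩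
        have hψ := psi_pos (β := β) hx hx0
        have h2 := abs_ev_le hβ hβ1 h hx hx0
        have h3 : |ev h x| ≤ ρ * (m * psi β x) := by
          calc |ev h x| ≤ m * ‖h‖ * psi β x := h2
            _ = ‖h‖ * (m * psi β x) := by ring
            _ ≤ _ := by gcongr
        have h4 := hf.mul_self_le hx (mul_pos hρ.1 (mul_pos hm0 hψ)) h3
        refine h4.trans ?_
        have h5 : ev h x ^ 2 ≤ ‖h‖ ^ 2 * (m * psi β x) ^ 2 := by
          rw [← mul_pow, ← sq_abs]
          exact pow_le_pow_left₀ (abs_nonneg _) (h2.trans_eq (by ring)) 2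
        calc _ ≤ ‖h‖ ^ 2 * (m * psi β x) ^ 2 * q (ρ * (m * psi β x)) x :=
              mul_le_mul_of_nonneg_right h5 (hq0 _ _)
          _ = _ := by simp only [hI]; ring
    _ = ‖h‖ ^ 2 * ∫ x in B, I ρ x := integral_const_mul _ _
    _ < ‖h‖ ^ 2 * 1 := by gcongr
    _ = _ := mul_one _

lemma continuous_dEnergy_line (hβ : 0 < β) (hβ1 : β < 1) (u φ χ : LapHilbert β) :
    Continuous fun q : ℝ × ℝ => dEnergy f (q.1 • u + q.2 • φ) χ := by
  unfold dEnergy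
  exact (by fun_prop : Continuous fun q : ℝ × ℝ => inner ℝ (q.1 • u + q.2 • φ) χ).sub
    (hf.continuous_integral_mul hβ hβ1 u φ χ)

lemma dEnergy_add_right (hβ : 0 < β) (hβ1 : β < 1) (h k l : LapHilbert β) :
    dEnergy f h (k + l) = dEnergy f h k + dEnergy f h l := by
  unfold dEnergy
  have : ∫ x in B, f x (ev h x) * ev (k + l) x =
      (∫ x in B, f x (ev h x) * ev k x) + ∫ x in B, f x (ev h x) * ev l x := by
    rw [← integral_add (hf.integrable_ev hβ hβ1 _ _) (hf.integrable_ev hβ hβ1 _ _)]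
    simp only [ev_add, mul_add]
  rw [inner_add_right, this]
  ring

/-- Points above the Nehari set are projected to it along rays. -/
lemma exists_smul_mem_lapNehari_of_le (hβ : 0 < β) (hβ1 : β < 1) {h : LapHilbert β} (hh : h ≠ 0)
    (hle : dEnergy f h h ≤ 0) : ∃ t : ℝ, 0 < t ∧ t ≤ 1 ∧ t • h ∈ lapNehari β f := by
  obtain ⟨ρ, hρ, hρ'⟩ := hf.exists_radius hβ hβ1
  have hn : 0 < ‖h‖ := norm_pos_iff.2 hh
  -- At `t₀` the norm is at most `ρ`, so the derivative along the ray is positive, while at `1` it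
  -- is nonpositive.
  set t₀ := min 1 (ρ / ‖h‖) with ht₀
  have ht₀0 : 0 < t₀ := by positivity
  have h1 : dEnergy f (t₀ • h) h > 0 := by
    have h2 := hρ' (t₀ • h) (smul_ne_zero ht₀0.ne' hh) (by
      rw [norm_smul, Real.norm_of_nonneg ht₀0.le]
      calc t₀ * ‖h‖ ≤ ρ / ‖h‖ * ‖h‖ := by gcongr; exact min_le_right _ _
        _ = ρ := by field_simp)
    have h3 : 0 < dEnergy f (t₀ • h) (t₀ • h) := by
      rw [dEnergy, real_inner_self_eq_norm_sq]; linarith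
    rw [dEnergy_smul_right] at h3
    exact pos_of_mul_pos_right h3 ht₀0.le
  have hc : Continuous fun t : ℝ => dEnergy f (t • h) h := by
    have := (hf.continuous_dEnergy_line hβ hβ1 h 0 h).comp
      (f := fun t : ℝ => (t, (0 : ℝ))) (by fun_prop)
    simpa [Function.comp_def] using this
  obtain ⟨t, ht, h0⟩ := intermediate_value_Icc' (min_le_left 1 (ρ / ‖h‖)) hc.continuousOn
    (show (0 : ℝ) ∈ Icc _ _ from ⟨by simpa using hle, h1.le⟩)
  have ht0 := ht₀0.trans_le ht.1
  refine ⟨t, ht0, ht.2, smul_ne_zero ht0.ne' hh, ?_⟩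
  simp only at h0
  rw [dEnergy_smul_right, h0, mul_zero]

lemma integrable_abs_rpow (hβ : 0 < β) (hβ1 : β < 1) (h : LapHilbert β) :
    IntegrableOn (fun x => |ev h x| ^ p) B := by
  have hC : 0 < Cp := by linarith [hf.one_lt]
  refine Integrable.mono' ((hf.integrable_ev hβ hβ1 h h).const_mul Cp⁻¹)
    ((aestronglyMeasurable_ev hβ h).norm.aemeasurable.pow_const p).aestronglyMeasurable ?_
  filter_upwards [ae_restrict_mem measurableSet_B] with x hx
  rw [Real.norm_of_nonneg (by positivity), inv_mul_eq_div, le_div_iff₀ hC, mul_comm]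
  exact hf.lower_mul_self hx _

lemma integral_abs_rpow_pos (hβ : 0 < β) (hβ1 : β < 1) {h : LapHilbert β} (hh : h ≠ 0) :
    0 < ∫ x in B, |ev h x| ^ p :=
  integral_pos_of_ne_zero hβ hβ1 hh (hf.integrable_abs_rpow hβ hβ1 h)
    (fun _ _ => by positivity) fun _ _ hx => Real.rpow_pos_of_pos (abs_pos.2 hx) _

/-- Every ray meets the Nehari set. -/
lemma exists_smul_mem_lapNehari (hβ : 0 < β) (hβ1 : β < 1) {h : LapHilbert β} (hh : h ≠ 0) :
    ∃ t : ℝ, 0 < t ∧ t • h ∈ lapNehari β f := by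
  have hp : 0 < p - 2 := by linarith [hf.lt_p, hf.two_lt]
  have hP := hf.integral_abs_rpow_pos hβ hβ1 hh
  set P := ∫ x in B, |ev h x| ^ p with hPd
  -- Since `f(x,t)t ≥ |t|^p` and `p > 2`, this `T` puts `T • h` on the nonpositive side of the
  -- Nehari set.
  obtain ⟨T, hT1, hT⟩ := ((tendsto_rpow_atTop hp).eventually_ge_atTop
    (‖h‖ ^ 2 / P)).and (eventually_gt_atTop 0) |>.exists
  have hle : dEnergy f (T • h) (T • h) ≤ 0 := by
    rw [dEnergy, real_inner_self_eq_norm_sq, norm_smul, Real.norm_of_nonneg hT.le, mul_pow]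
    have h1 : ∫ x in B, |ev (T • h) x| ^ p ≤ ∫ x in B, f x (ev (T • h) x) * ev (T • h) x := by
      refine setIntegral_mono_on (hf.integrable_abs_rpow hβ hβ1 _)
        (hf.integrable_ev hβ hβ1 _ _) measurableSet_B fun x hx => ?_
      refine le_trans ?_ (hf.lower_mul_self hx _)
      exact le_mul_of_one_le_left (by positivity) hf.one_lt.le
    rw [integral_abs_rpow_smul h hT.le, ← hPd] at h1
    rw [div_le_iff₀ hP] at hT1
    have e : T ^ p = T ^ 2 * T ^ (p - 2) := by
      rw [← Real.rpow_natCast, ← Real.rpow_add hT]; congr 1; push_cast; ring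
    rw [e] at h1
    nlinarith [mul_le_mul_of_nonneg_left hT1 (sq_nonneg T)]
  obtain ⟨t, ht, -, hmem⟩ :=
    hf.exists_smul_mem_lapNehari_of_le hβ hβ1 (smul_ne_zero hT.ne' hh) hle
  exact ⟨t * T, by positivity, by rwa [mul_smul]⟩

/-- The ray inequality, integrated. -/
lemma integral_primitive_ray (hβ : 0 < β) (hβ1 : β < 1) (h : LapHilbert β) {t : ℝ} (ht : 0 ≤ t) :
    (∫ x in B, primitive f x (ev h x)) + (t ^ 2 - 1) / 2 * ∫ x in B, f x (ev h x) * ev h x ≤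
      ∫ x in B, primitive f x (ev (t • h) x) := by
  rw [← integral_const_mul, ← integral_add (hf.integrable_primitive_ev hβ hβ1 h)
    ((hf.integrable_ev hβ hβ1 h h).const_mul _)]
  refine setIntegral_mono_on ((hf.integrable_primitive_ev hβ hβ1 h).add
    ((hf.integrable_ev hβ hβ1 h h).const_mul _)) (hf.integrable_primitive_ev hβ hβ1 _)
    measurableSet_B fun x hx => ?_
  rw [ev_smul]
  exact hf.primitive_ray hx _ ht

/-- An element of the Nehari set maximises the energy on its ray. -/
lemma energy_smul_le (hβ : 0 < β) (hβ1 : β < 1) {h : LapHilbert β} (hh : h ∈ lapNehari β f)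
    {t : ℝ} (ht : 0 ≤ t) : energy f (t • h) ≤ energy f h := by
  have h1 := hf.integral_primitive_ray hβ hβ1 h ht
  rw [← norm_sq_of_mem_lapNehari hh] at h1
  unfold energy
  rw [norm_smul, mul_pow, Real.norm_eq_abs, sq_abs]
  linarith

lemma le_energy (hβ : 0 < β) (hβ1 : β < 1) {h : LapHilbert β} (hh : h ∈ lapNehari β f) :
    (1 / 2 - 1 / θ) * ‖h‖ ^ 2 ≤ energy f h := by
  have hθ : 0 < θ := by linarith [hf.two_lt]
  have h1 : ∫ x in B, θ * primitive f x (ev h x) ≤ ∫ x in B, f x (ev h x) * ev h x :=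
    setIntegral_mono_on ((hf.integrable_primitive_ev hβ hβ1 h).const_mul _)
      (hf.integrable_ev hβ hβ1 h h) measurableSet_B fun x hx => hf.theta_mul_primitive_le hx _
  rw [integral_const_mul, ← norm_sq_of_mem_lapNehari hh] at h1
  have h2 : ∫ x in B, primitive f x (ev h x) ≤ ‖h‖ ^ 2 / θ := by
    rw [le_div_iff₀ hθ]; linarith
  unfold energy
  calc (1 / 2 - 1 / θ) * ‖h‖ ^ 2 = 1 / 2 * ‖h‖ ^ 2 - ‖h‖ ^ 2 / θ := by ring
    _ ≤ _ := by linarith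

/-- The derivative changes sign strictly along rays through the Nehari set. -/
lemma dEnergy_ray_sign (hβ : 0 < β) (hβ1 : β < 1) {h : LapHilbert β} (hh : h ∈ lapNehari β f)
    {t : ℝ} (ht : 0 < t) :
    (t < 1 → 0 < dEnergy f (t • h) h) ∧ (1 < t → dEnergy f (t • h) h < 0) := by
  have e : inner ℝ (t • h) h = t * inner ℝ h h := real_inner_smul_left h h t
  have key : dEnergy f (t • h) h =
      ∫ x in B, (t * (f x (ev h x) * ev h x) - f x (ev (t • h) x) * ev h x) := by
    rw [integral_sub ((hf.integrable_ev hβ hβ1 h h).const_mul _) (hf.integrable_ev hβ hβ1 _ _),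
      integral_const_mul, ← norm_sq_of_mem_lapNehari hh, dEnergy, e,
      real_inner_self_eq_norm_sq]
  have hint : IntegrableOn (fun x => t * (f x (ev h x) * ev h x) - f x (ev (t • h) x) * ev h x) B :=
    ((hf.integrable_ev hβ hβ1 h h).const_mul _).sub (hf.integrable_ev hβ hβ1 _ _)
  constructor
  · intro ht1
    have hpos : ∀ x ∈ B, ev h x ≠ 0 →
        0 < t * (f x (ev h x) * ev h x) - f x (ev (t • h) x) * ev h x := by
      intro x hx hne
      rw [ev_smul]
      linarith [hf.mul_lt_of_lt_one hx hne ht ht1]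
    rw [key]
    refine integral_pos_of_ne_zero hβ hβ1 hh.1 hint (fun x hx => ?_) hpos
    by_cases hne : ev h x = 0
    · simp [hne]
    · exact (hpos x hx hne).le
  · intro ht1
    have hpos : ∀ x ∈ B, ev h x ≠ 0 →
        0 < -(t * (f x (ev h x) * ev h x) - f x (ev (t • h) x) * ev h x) := by
      intro x hx hne
      rw [ev_smul]
      linarith [hf.mul_gt_of_one_lt hx hne ht1]
    have := integral_pos_of_ne_zero hβ hβ1 hh.1 hint.neg (fun x hx => ?_) hpos
    · rw [key]
      simp only [Pi.neg_apply, integral_neg] at this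
      linarith
    by_cases hne : ev h x = 0
    · simp [hne]
    · exact (hpos x hx hne).le

lemma hasDerivAt_energy (hβ : 0 < β) (hβ1 : β < 1) (u φ : LapHilbert β) (b : ℝ) :
    HasDerivAt (fun b : ℝ => energy f (u + b • φ)) (dEnergy f (u + b • φ) φ) b := by
  have h1 : HasDerivAt (fun b : ℝ => u + b • φ) φ b := by
    have := ((hasDerivAt_id b).smul_const φ).const_add u
    rwa [one_smul] at this
  have h2 := (h1.norm_sq.const_mul (1 / 2)).sub (hf.hasDerivAt_integral_primitive hβ hβ1 u φ b)
  refine h2.congr_deriv ?_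
  unfold dEnergy
  ring

/-- A minimiser of the energy on the Nehari set is a critical point. -/
lemma dEnergy_eq_zero_of_minimizer (hβ : 0 < β) (hβ1 : β < 1) {u : LapHilbert β}
    (hu : u ∈ lapNehari β f) (hmin : ∀ v ∈ lapNehari β f, energy f u ≤ energy f v)
    (φ : LapHilbert β) : dEnergy f u φ = 0 := by
  -- One inequality suffices, because it can be applied to `-φ`.
  have main : ∀ φ : LapHilbert β, 0 ≤ dEnergy f u φ := by
    intro φ
    by_contra! hneg
    have hc := hf.continuous_dEnergy_line hβ hβ1 u φ φ
    have hev : ∀ᶠ q : ℝ × ℝ in 𝓝 (1, 0), dEnergy f (q.1 • u + q.2 • φ) φ < 0 := by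
      refine (hc.tendsto (1, 0)).eventually_lt_const ?_
      simpa using hneg
    obtain ⟨r, hr, hball⟩ := Metric.eventually_nhds_iff_ball.1 hev
    -- Keeps `t ∈ [1-κ, 1+κ]` positive and within the ball where the derivative in direction `φ` is
    -- negative.
    set κ := min (r / 2) (1 / 2) with hκ
    have hκ0 : 0 < κ := by positivity
    have hκr : κ < r := (min_le_left _ _).trans_lt (by linarith)
    have hκ1 : κ < 1 := (min_le_right _ _).trans_lt (by norm_num)
    -- the perturbed ray `t (u + s φ)` crosses the Nehari set near `t = 1`
    have hcont : ∀ t : ℝ, Continuous fun s : ℝ => dEnergy f (t • (u + s • φ)) (u + s • φ) := by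
      intro t
      have e : (fun s : ℝ => dEnergy f (t • (u + s • φ)) (u + s • φ)) = fun s =>
          dEnergy f (t • u + (t * s) • φ) u + s * dEnergy f (t • u + (t * s) • φ) φ := by
        ext s
        rw [hf.dEnergy_add_right hβ hβ1, dEnergy_smul_right, smul_add, smul_smul]
      rw [e]
      have h1 := (hf.continuous_dEnergy_line hβ hβ1 u φ u).comp
        (f := fun s : ℝ => (t, t * s)) (by fun_prop)
      have h2 := hc.comp (f := fun s : ℝ => (t, t * s)) (by fun_prop)
      exact h1.add (continuous_id.mul h2)
    have hsl : ∀ᶠ s : ℝ in 𝓝 0, 0 < dEnergy f ((1 - κ) • (u + s • φ)) (u + s • φ) := by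
      refine ((hcont (1 - κ)).tendsto 0).eventually_const_lt ?_
      simpa using (hf.dEnergy_ray_sign hβ hβ1 hu (t := 1 - κ) (by linarith)).1 (by linarith)
    have hsr : ∀ᶠ s : ℝ in 𝓝 0, dEnergy f ((1 + κ) • (u + s • φ)) (u + s • φ) < 0 := by
      refine ((hcont (1 + κ)).tendsto 0).eventually_lt_const ?_
      simpa using (hf.dEnergy_ray_sign hβ hβ1 hu (t := 1 + κ) (by linarith)).2 (by linarith)
    have hsmall : ∀ᶠ s : ℝ in 𝓝 0, (1 + κ) * s < r :=
      ((continuous_const_mul (1 + κ)).tendsto 0).eventually_lt_const (by simpa using hr)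
    obtain ⟨s, ⟨⟨h1, h2⟩, h3⟩, hs⟩ := (((hsl.and hsr).and hsmall).filter_mono
      (nhdsWithin_le_nhds (s := Ioi 0)) |>.and self_mem_nhdsWithin).exists
    have hs0 : 0 < s := hs
    set v := u + s • φ with hv
    have hct : Continuous fun t : ℝ => dEnergy f (t • v) v := by
      have := (hf.continuous_dEnergy_line hβ hβ1 v 0 v).comp
        (f := fun t : ℝ => (t, (0 : ℝ))) (by fun_prop)
      simpa [Function.comp_def] using this
    obtain ⟨t, ht, ht0⟩ := intermediate_value_Icc' (show 1 - κ ≤ 1 + κ by linarith)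
      hct.continuousOn (show (0 : ℝ) ∈ Icc _ _ from ⟨h2.le, h1.le⟩)
    simp only at ht0
    have htpos : 0 < t := by linarith [ht.1]
    have hv0 : v ≠ 0 := by
      intro h0
      rw [h0] at h1
      simp [dEnergy] at h1
    have hmem : t • v ∈ lapNehari β f :=
      ⟨smul_ne_zero htpos.ne' hv0, by rw [dEnergy_smul_right, ht0, mul_zero]⟩
    have hle := hmin _ hmem
    have hts : 0 < t * s := mul_pos htpos hs0
    -- Mean value theorem from `t • u` to `t • v` in direction `φ`: the energy strictly decreases,
    -- and `t • u` already lies below `u` by `energy_smul_le`, against minimality.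
    obtain ⟨b, hb, hslope⟩ := exists_hasDerivAt_eq_slope (fun b : ℝ => energy f (t • u + b • φ))
      (fun b => dEnergy f (t • u + b • φ) φ) hts
      (fun b _ => (hf.hasDerivAt_energy hβ hβ1 (t • u) φ b).continuousAt.continuousWithinAt)
      (fun b _ => hf.hasDerivAt_energy hβ hβ1 (t • u) φ b)
    have hbneg : dEnergy f (t • u + b • φ) φ < 0 := by
      refine hball (t, b) ?_
      rw [Metric.mem_ball, Prod.dist_eq, max_lt_iff]
      simp only [Real.dist_eq, sub_zero]
      refine ⟨?_, ?_⟩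
      · rw [abs_lt]; constructor <;> linarith [ht.1, ht.2]
      · rw [abs_of_pos hb.1]
        calc b < t * s := hb.2
          _ ≤ (1 + κ) * s := by gcongr; exact ht.2
          _ < r := h3
    rw [hslope, sub_zero, div_neg_iff] at hbneg
    have e1 : t • u + (t * s) • φ = t • v := by rw [hv, smul_add, smul_smul]
    have h5 : energy f (t • v) < energy f (t • u) := by
      rcases hbneg with h | h
      · linarith [h.2]
      · have := h.1
        rw [e1, zero_smul, add_zero] at this
        linarith
    linarith [hf.energy_smul_le hβ hβ1 hu htpos.le]
  refine le_antisymm ?_ (main φ)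
  have h1 := main ((-1 : ℝ) • φ)
  rw [dEnergy_smul_right] at h1
  linarith

/-! ### Existence of a minimiser. -/

/-- The energy attains its infimum on the Nehari set if the infimum is subcritical. -/
lemma exists_minimizer (hβ : 0 < β) (hβ1 : β < 1) {M : ℝ} (hM0 : 0 < M)
    (hM : α * (radialConst β * M) ^ gammaExp β < 4) {v : LapHilbert β}
    (hv : v ∈ lapNehari β f) (hvM : energy f v < (1 / 2 - 1 / θ) * M ^ 2) :
    ∃ u ∈ lapNehari β f, ∀ v ∈ lapNehari β f, energy f u ≤ energy f v := by
  have hθ : 0 < 1 / 2 - 1 / θ := by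
    rw [sub_pos]; exact one_div_lt_one_div_of_lt two_pos hf.two_lt
  set S := energy f '' lapNehari β f with hS
  have hbdd : BddBelow S := ⟨0, by
    rintro _ ⟨h, hh, rfl⟩
    exact (mul_nonneg hθ.le (sq_nonneg _)).trans (hf.le_energy hβ hβ1 hh)⟩
  have hvS : energy f v ∈ S := mem_image_of_mem _ hv
  obtain ⟨e, -, helim, heS⟩ := exists_seq_tendsto_sInf ⟨_, hvS⟩ hbdd
  have hlt : sInf S < (1 / 2 - 1 / θ) * M ^ 2 := (csInf_le hbdd hvS).trans_lt hvM
  obtain ⟨N, hN⟩ := eventually_atTop.1 (helim.eventually_lt_const hlt)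
  -- The shift by `N` puts every term below the threshold, so all norms are at most `M` and one
  -- majorant serves them all.
  choose g hg hge using fun n => heS (n + N)
  have hgM : ∀ n, ‖g n‖ ≤ M := by
    intro n
    have h1 := (hf.le_energy hβ hβ1 (hg n)).trans_lt (by rw [hge]; exact hN _ (by omega))
    exact (lt_of_pow_lt_pow_left₀ 2 hM0.le (lt_of_mul_lt_mul_left h1 hθ.le)).le
  have hsep := separableSpace_lapHilbert β
  obtain ⟨u, ns, hns, hweak⟩ := exists_weakly_convergent_subseq hgM
  have hev := tendsto_ev_of_weak hweak
  have hr0 := radialConst_pos hβ1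
  have hdom := dominant_mul_psi hβ hβ1 (by positivity) hM
  have hb : ∀ n, ∀ x ∈ B, x ≠ 0 → |ev (g (ns n)) x| ≤ radialConst β * M * psi β x := by
    intro n x hx hx0
    refine (abs_ev_le hβ hβ1 _ hx hx0).trans ?_
    have := psi_nonneg (β := β) hx hx0
    gcongr
    exact hgM _
  have l1 : Tendsto (fun n => ‖g (ns n)‖ ^ 2) atTop (𝓝 (∫ x in B, f x (ev u x) * ev u x)) := by
    simp only [norm_sq_of_mem_lapNehari (hg _)]
    exact hf.tendsto_integral_mul hβ1 hdom (fun n => aestronglyMeasurable_ev hβ _)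
      (fun n => aestronglyMeasurable_ev hβ _)
      (Eventually.of_forall fun n x hx hx0 => ⟨hb n x hx hx0, hb n x hx hx0⟩)
      (fun x _ _ => hev x) (fun x _ _ => hev x)
  have l2 : Tendsto (fun n => ∫ x in B, primitive f x (ev (g (ns n)) x)) atTop
      (𝓝 (∫ x in B, primitive f x (ev u x))) :=
    hf.tendsto_integral_primitive hβ1 hdom (fun n => aestronglyMeasurable_ev hβ _)
      (Eventually.of_forall fun n x hx hx0 => hb n x hx hx0) (fun x _ _ => hev x)
  set Λ := ∫ x in B, f x (ev u x) * ev u x with hΛ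
  have henergy : sInf S = 1 / 2 * Λ - ∫ x in B, primitive f x (ev u x) := by
    have h1 : Tendsto (fun n => energy f (g (ns n))) atTop (𝓝 (sInf S)) := by
      simp only [hge]
      exact helim.comp ((tendsto_add_atTop_nat N).comp hns.tendsto_atTop)
    exact tendsto_nhds_unique h1 ((l1.const_mul (1 / 2)).sub l2)
  obtain ⟨ρ, hρ, hρ'⟩ := hf.exists_radius hβ hβ1
  -- Norms on the Nehari set are bounded below by `ρ`, and `‖g‖²` tends to `Λ`; this excludes `u =
  -- 0`.
  have hΛpos : 0 < Λ := by
    refine lt_of_lt_of_le (pow_pos hρ 2) (ge_of_tendsto' l1 fun n => ?_)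
    by_contra! hlt
    have h1 := hρ' _ (hg (ns n)).1 (le_of_sq_le_sq hlt.le hρ.le)
    rw [← norm_sq_of_mem_lapNehari (hg _)] at h1
    exact lt_irrefl _ h1
  have hu0 : u ≠ 0 := by
    intro h0
    rw [hΛ, h0] at hΛpos
    simp at hΛpos
  -- Weak lower semicontinuity of the norm.
  have hule : ‖u‖ ^ 2 ≤ Λ := by
    have h1 := hweak u
    rw [real_inner_self_eq_norm_sq] at h1
    have h2 : Tendsto (fun n => ‖g (ns n)‖ * ‖u‖) atTop (𝓝 (√Λ * ‖u‖)) := by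
      refine Tendsto.mul_const _ ?_
      have := (Real.continuous_sqrt.tendsto Λ).comp l1
      simpa [Function.comp_def] using this
    have h3 := le_of_tendsto_of_tendsto' h1 h2 fun n => real_inner_le_norm _ _
    have h4 : ‖u‖ ≤ √Λ := by
      rw [pow_two] at h3
      exact le_of_mul_le_mul_right h3 (norm_pos_iff.2 hu0)
    calc ‖u‖ ^ 2 ≤ √Λ ^ 2 := by gcongr
      _ = Λ := Real.sq_sqrt hΛpos.le
  obtain ⟨t, ht, ht1, hmem⟩ := hf.exists_smul_mem_lapNehari_of_le hβ hβ1 hu0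
    (by rw [dEnergy, real_inner_self_eq_norm_sq]; linarith)
  refine ⟨t • u, hmem, fun v hv => le_trans ?_ (csInf_le hbdd (mem_image_of_mem _ hv))⟩
  have h1 := hf.integral_primitive_ray hβ hβ1 u ht.le
  rw [← hΛ] at h1
  rw [henergy, energy, norm_smul, mul_pow, Real.norm_eq_abs, sq_abs]
  -- `J(tu) ≤ t²‖u‖²/2 - ∫F(u) - (t²-1)Λ/2 ≤ Λ/2 - ∫F(u)`, which is the infimum.
  nlinarith [mul_le_mul_of_nonneg_left hule (sq_nonneg t)]

end IsNonlinearity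

/-! ### Transfer between functions of `𝐄` and their Laplacians. -/

lemma exists_ev_of_mem_E {β : ℝ} (hβ : 0 < β) (hβ1 : β < 1) {u : R4 → ℝ} (hu : u ∈ E β) :
    ∃ h : LapHilbert β, u =ᵐ[volume.restrict B] ev h ∧
      lap u =ᵐ[weightedMeasure β] (h : WL2 β) := by
  obtain ⟨h, hh, huh⟩ := exists_mem_lapSpace hβ hu
  exact ⟨⟨h, hh⟩, huh, (mem_E_of_ae_eq_evalG hβ hβ1 hh huh).2⟩

lemma ev_mem_E {β : ℝ} (hβ : 0 < β) (hβ1 : β < 1) (h : LapHilbert β) :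
    ev h ∈ E β ∧ lap (ev h) =ᵐ[weightedMeasure β] (h : WL2 β) :=
  mem_E_of_ae_eq_evalG hβ hβ1 h.2 EventuallyEq.rfl

section Transfer

variable {β : ℝ} {f : R4 → ℝ → ℝ} {u v : R4 → ℝ} {h k : LapHilbert β}

lemma J_eq_energy (hβ : 0 < β) (hu : u =ᵐ[volume.restrict B] ev h)
    (hl : lap u =ᵐ[weightedMeasure β] (h : WL2 β)) : J β f u = energy f h := by
  rw [J, energy, ip_eq_inner hβ hl hl, real_inner_self_eq_norm_sq]
  congr 1
  refine integral_congr_ae ?_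
  filter_upwards [hu] with x hx
  rw [hx]

lemma J'_eq_dEnergy (hβ : 0 < β) (hu : u =ᵐ[volume.restrict B] ev h)
    (hl : lap u =ᵐ[weightedMeasure β] (h : WL2 β)) (hv : v =ᵐ[volume.restrict B] ev k)
    (hk : lap v =ᵐ[weightedMeasure β] (k : WL2 β)) : J' β f u v = dEnergy f h k := by
  rw [J', dEnergy, ip_eq_inner hβ hl hk]
  congr 1
  refine integral_congr_ae ?_
  filter_upwards [hu, hv] with x hx hx'
  rw [hx, hx']

lemma ne_zero_of_ae (hu : u =ᵐ[volume.restrict B] ev h)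
    (h0 : ¬ u =ᵐ[volume.restrict B] 0) : h ≠ 0 := by
  rintro rfl
  exact h0 (hu.trans (ae_of_all _ fun x => ev_zero x))

lemma mem_lapNehari_of_mem_nehari (hβ : 0 < β) (hu : u =ᵐ[volume.restrict B] ev h)
    (hl : lap u =ᵐ[weightedMeasure β] (h : WL2 β)) (hN : u ∈ nehari β f) : h ∈ lapNehari β f :=
  ⟨ne_zero_of_ae hu hN.2.1, by rw [← J'_eq_dEnergy hβ hu hl hu hl]; exact hN.2.2⟩

end Transfer

/-! ### The power nonlinearity and the comparison of levels. -/

/-- Elements of the Nehari set of the power nonlinearity, in terms of Laplacians. -/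
lemma exists_of_mem_nehariP {β p : ℝ} (hβ : 0 < β) (hβ1 : β < 1) {u : R4 → ℝ}
    (hu : u ∈ nehariP β p) : ∃ h : LapHilbert β, h ≠ 0 ∧ ‖h‖ ^ 2 = ∫ x in B, |ev h x| ^ p ∧
      Jp β p u = (1 / 2 - 1 / p) * ‖h‖ ^ 2 := by
  obtain ⟨hE, hne, h0⟩ := hu
  obtain ⟨h, hu, hl⟩ := exists_ev_of_mem_E hβ hβ1 hE
  have e : ∫ x in B, |u x| ^ p = ∫ x in B, |ev h x| ^ p := by
    refine integral_congr_ae ?_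
    filter_upwards [hu] with x hx
    rw [hx]
  have e2 : ip β u u = ‖h‖ ^ 2 := by
    rw [ip_eq_inner hβ hl hl, real_inner_self_eq_norm_sq]
    rfl
  rw [e, e2] at h0
  refine ⟨h, ne_zero_of_ae hu hne, by linarith, ?_⟩
  rw [Jp, e, e2, show ∫ x in B, |ev h x| ^ p = ‖h‖ ^ 2 by linarith]
  ring

/-- The radial lemma again: every power of `psi` is integrable, being a power of a logarithm. -/
lemma integral_abs_ev_rpow_le {β p : ℝ} (hβ : 0 < β) (hβ1 : β < 1) (hp : 0 ≤ p) :
    ∃ K, 0 < K ∧ ∀ h : LapHilbert β, ∫ x in B, |ev h x| ^ p ≤ K * ‖h‖ ^ p := by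
  have hr := radialConst_pos hβ1
  have hint : IntegrableOn (fun x => (radialConst β * psi β x) ^ p) B := by
    have h1 := (integrableOn_logInv_rpow_mul_exp (k := (1 - β) / 2 * p) (q := 0)
      (mul_nonneg (by linarith) hp) (by norm_num)).const_mul (radialConst β ^ p)
    refine Integrable.congr h1 ?_
    filter_upwards [ae_mem_B_ne_zero] with x ⟨hx, hx0⟩
    have hL := one_le_logInv hx hx0
    rw [Real.mul_rpow hr.le (psi_nonneg hx hx0), psi, ← Real.rpow_mul (by linarith)]
    simp
  have h0 : 0 ≤ ∫ x in B, (radialConst β * psi β x) ^ p := by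
    refine integral_nonneg_of_ae ?_
    filter_upwards [ae_mem_B_ne_zero] with x ⟨hx, hx0⟩
    exact Real.rpow_nonneg (mul_nonneg hr.le (psi_nonneg hx hx0)) _
  refine ⟨(∫ x in B, (radialConst β * psi β x) ^ p) + 1, by linarith, fun h => ?_⟩
  calc ∫ x in B, |ev h x| ^ p ≤ ∫ x in B, (radialConst β * psi β x) ^ p * ‖h‖ ^ p := by
        refine integral_mono_of_nonneg (ae_of_all _ fun x => by positivity)
          (hint.mul_const _) ?_
        filter_upwards [ae_mem_B_ne_zero] with x ⟨hx, hx0⟩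
        rw [← Real.mul_rpow (mul_nonneg hr.le (psi_nonneg hx hx0)) (norm_nonneg _)]
        exact Real.rpow_le_rpow (abs_nonneg _)
          ((abs_ev_le hβ hβ1 h hx hx0).trans_eq (by ring)) hp
    _ = (∫ x in B, (radialConst β * psi β x) ^ p) * ‖h‖ ^ p := integral_mul_const _ _
    _ ≤ _ := by gcongr; linarith

/-- The auxiliary ground-state level is positive. -/
lemma mp_pos {β p : ℝ} (hβ : 0 < β) (hβ1 : β < 1) (hp : 2 < p)
    (hne : (nehariP β p).Nonempty) : 0 < mp β p := by
  obtain ⟨K, hK, hle⟩ := integral_abs_ev_rpow_le hβ hβ1 (show 0 ≤ p by linarith)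
  have hp' : 0 < 1 / 2 - 1 / p := sub_pos.2 (one_div_lt_one_div_of_lt two_pos hp)
  -- On this Nehari set `‖h‖² ≤ K‖h‖^p`, so `‖h‖^(p-2) ≥ 1/K`. Nonemptiness matters, as the real
  -- infimum of the empty set is `0`.
  refine lt_of_lt_of_le (show 0 < (1 / 2 - 1 / p) * (1 / K) ^ (2 / (p - 2)) by positivity)
    (le_csInf (hne.image _) ?_)
  rintro _ ⟨u, hu, rfl⟩
  obtain ⟨h, hh, hsq, hJ⟩ := exists_of_mem_nehariP hβ hβ1 hu
  have hn : 0 < ‖h‖ := norm_pos_iff.2 hh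
  rw [hJ]
  refine mul_le_mul_of_nonneg_left ?_ hp'.le
  have h1 := hsq.trans_le (hle h)
  have e : ‖h‖ ^ p = ‖h‖ ^ 2 * ‖h‖ ^ (p - 2) := by
    rw [← Real.rpow_natCast, ← Real.rpow_add hn]; congr 1; push_cast; ring
  have h2 : 1 / K ≤ ‖h‖ ^ (p - 2) := by
    rw [div_le_iff₀ hK]
    rw [e] at h1
    have h3 : 0 < ‖h‖ ^ 2 := by positivity
    nlinarith
  calc (1 / K) ^ (2 / (p - 2)) ≤ (‖h‖ ^ (p - 2)) ^ (2 / (p - 2)) :=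
        Real.rpow_le_rpow (by positivity) h2 (div_nonneg two_pos.le (by linarith))
    _ = ‖h‖ ^ 2 := by
        have : p - 2 ≠ 0 := by linarith
        rw [← Real.rpow_mul hn.le, mul_div_cancel₀ _ this, Real.rpow_two]

/-- Maximum of the fibering map of a power nonlinearity. -/
lemma sq_sub_rpow_le {p c t : ℝ} (hp : 2 < p) (hc : 0 < c) (ht : 0 ≤ t) :
    t ^ 2 / 2 - c * t ^ p / p ≤ (1 / 2 - 1 / p) * c ^ (-(2 / (p - 2))) := by
  have hp2 : 0 < p - 2 := by linarith
  have hp0 : 0 < p := by linarith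
  -- The scaling `τ = t d` reduces to `c = 1`; Bernoulli's inequality for `(1 + (τ² - 1))^(p/2)`
  -- then gives the maximum `1/2 - 1/p`.
  set d := c ^ (1 / (p - 2)) with hd
  have hd0 : 0 < d := Real.rpow_pos_of_pos hc _
  set τ := t * d with hτ
  have hτ0 : 0 ≤ τ := by positivity
  have e0 : c ^ (-(2 / (p - 2))) * d ^ 2 = 1 := by
    rw [hd, ← Real.rpow_natCast, ← Real.rpow_mul hc.le, ← Real.rpow_add hc]
    convert Real.rpow_zero c using 2
    push_cast; ring
  have e1 : c ^ (-(2 / (p - 2))) * d ^ p = c := by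
    rw [hd, ← Real.rpow_mul hc.le, ← Real.rpow_add hc]
    convert Real.rpow_one c using 2
    field_simp; ring
  have hb := one_add_mul_self_le_rpow_one_add (s := τ ^ 2 - 1) (by nlinarith) (p := p / 2)
    (by linarith)
  have e2 : (1 + (τ ^ 2 - 1)) ^ (p / 2) = τ ^ p := by
    rw [add_sub_cancel, ← Real.rpow_natCast, ← Real.rpow_mul hτ0]
    congr 1; push_cast; ring
  rw [e2, hτ, Real.mul_rpow ht hd0.le] at hb
  have h1 : t ^ 2 * d ^ 2 / 2 - t ^ p * d ^ p / p ≤ 1 / 2 - 1 / p := by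
    rw [div_sub_div _ _ two_ne_zero hp0.ne', div_sub_div _ _ two_ne_zero hp0.ne',
      div_le_div_iff_of_pos_right (by positivity)]
    nlinarith
  have hk : 0 ≤ c ^ (-(2 / (p - 2))) := Real.rpow_nonneg hc.le _
  calc t ^ 2 / 2 - c * t ^ p / p
      = (t ^ 2 * d ^ 2 / 2 - t ^ p * d ^ p / p) * c ^ (-(2 / (p - 2))) := by
        linear_combination (-t ^ 2 / 2) * e0 + (t ^ p / p) * e1
    _ ≤ _ := mul_le_mul_of_nonneg_right h1 hk

/-- The threshold under which the energy is compact, in terms of the sharp constant. -/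
lemma alpha_mul_rpow_lt {β α : ℝ} (hβ1 : β < 1) (hα : 0 < α) :
    α * (radialConst β * √(((2 * α / alphaSharp β) ^ (1 - β))⁻¹)) ^ gammaExp β < 4 := by
  have h1 : 0 < 1 - β := by linarith
  have hD : 0 < 8 * Real.pi ^ 2 * (1 - β) := by positivity
  have ha : 0 < alphaSharp β := mul_pos four_pos (Real.rpow_pos_of_pos hD _)
  -- Here `radialConst^γ = 4/α_β` and the root contributes `α_β/(2α)`, so the left side of the claim
  -- equals `2`.
  have e : (radialConst β * √(((2 * α / alphaSharp β) ^ (1 - β))⁻¹)) ^ gammaExp β = 2 / α := by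
    rw [radialConst, ← Real.sqrt_mul (by positivity), Real.sqrt_eq_rpow,
      ← Real.rpow_mul (by positivity), gammaExp, show 1 / 2 * (2 / (1 - β)) = 1 / (1 - β) by ring,
      Real.mul_rpow (by positivity) (by positivity), ← Real.inv_rpow (by positivity),
      ← Real.rpow_mul (by positivity), mul_one_div_cancel h1.ne', Real.rpow_one, one_div,
      Real.inv_rpow hD.le, alphaSharp]
    have := Real.rpow_pos_of_pos hD (1 / (1 - β))
    rw [one_div] at *
    field_simp
    norm_num
  rw [e, mul_div_cancel₀ _ hα.ne']
  norm_num

namespace IsNonlinearity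

variable {β α C θ p Cp : ℝ} {f : R4 → ℝ → ℝ} (hf : IsNonlinearity β α C θ p Cp f)
include hf

lemma nehariP_nonempty (hβ : 0 < β) (hβ1 : β < 1) : (nehariP β p).Nonempty := by
  have hp : 0 < p - 2 := by linarith [hf.lt_p, hf.two_lt]
  obtain ⟨h₀, hmem, hne⟩ := exists_ne_zero_mem_lapSpace hβ
  set h : LapHilbert β := ⟨h₀, hmem⟩ with hh
  have hh0 : h ≠ 0 := fun h0 => hne (congrArg Subtype.val h0)
  have hP := hf.integral_abs_rpow_pos hβ hβ1 hh0
  have hn : 0 < ‖h‖ := norm_pos_iff.2 hh0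
  set P := ∫ x in B, |ev h x| ^ p with hPd
  -- Solves `t² ‖h‖² = t^p P`.
  set t := (‖h‖ ^ 2 / P) ^ (1 / (p - 2)) with ht
  have ht0 : 0 < t := by positivity
  have e1 : t ^ (p - 2) = ‖h‖ ^ 2 / P := by
    rw [ht, ← Real.rpow_mul (by positivity), one_div_mul_cancel hp.ne', Real.rpow_one]
  have e2 : t ^ p = t ^ 2 * t ^ (p - 2) := by
    rw [← Real.rpow_natCast, ← Real.rpow_add ht0]; congr 1; push_cast; ring
  obtain ⟨hE, hl⟩ := ev_mem_E hβ hβ1 (t • h)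
  refine ⟨ev (t • h), hE, not_ev_ae_eq_zero hβ hβ1 (smul_ne_zero ht0.ne' hh0), ?_⟩
  have e3 : ip β (ev (t • h)) (ev (t • h)) = ‖t • h‖ ^ 2 := by
    rw [ip_eq_inner hβ hl hl, real_inner_self_eq_norm_sq]
    rfl
  rw [e3, integral_abs_rpow_smul h ht0.le, ← hPd, e2, e1, norm_smul, mul_pow,
    Real.norm_of_nonneg ht0.le]
  field_simp
  ring

/-- Comparison of the Nehari level with that of the power nonlinearity. -/
lemma exists_energy_le (hβ : 0 < β) (hβ1 : β < 1) {h : LapHilbert β} (hh : h ≠ 0)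
    (hsq : ‖h‖ ^ 2 = ∫ x in B, |ev h x| ^ p) :
    ∃ v ∈ lapNehari β f, energy f v ≤
      (1 / 2 - 1 / p) * ‖h‖ ^ 2 * Cp ^ (-(2 / (p - 2))) := by
  have hC : 0 < Cp := by linarith [hf.one_lt]
  have hp : 2 < p := by linarith [hf.lt_p, hf.two_lt]
  obtain ⟨t, ht, hmem⟩ := hf.exists_smul_mem_lapNehari hβ hβ1 hh
  refine ⟨t • h, hmem, ?_⟩
  have h1 : ∫ x in B, Cp / p * |ev (t • h) x| ^ p ≤ ∫ x in B, primitive f x (ev (t • h) x) := by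
    refine setIntegral_mono_on ((hf.integrable_abs_rpow hβ hβ1 _).const_mul _)
      (hf.integrable_primitive_ev hβ hβ1 _) measurableSet_B fun x hx => ?_
    refine le_trans (le_of_eq ?_) (hf.lower_primitive hx _)
    ring
  rw [integral_const_mul, integral_abs_rpow_smul h ht.le, ← hsq] at h1
  have h2 := mul_le_mul_of_nonneg_right (sq_sub_rpow_le hp hC ht.le) (sq_nonneg ‖h‖)
  rw [energy, norm_smul, mul_pow, Real.norm_of_nonneg ht.le]
  calc _ ≤ 1 / 2 * (t ^ 2 * ‖h‖ ^ 2) - Cp / p * (t ^ p * ‖h‖ ^ 2) := by linarith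
    _ = (t ^ 2 / 2 - Cp * t ^ p / p) * ‖h‖ ^ 2 := by ring
    _ ≤ _ := h2.trans_eq (by ring)

/-- The lower bound of `f` by a power makes the Nehari level subcritical. -/
lemma exists_subcritical (hβ : 0 < β) (hβ1 : β < 1)
    (hCp : (2 * θ * mp β p / (θ - 2) * (2 * α / alphaSharp β) ^ (1 - β)) ^ ((p - 2) / 2) < Cp) :
    ∃ v ∈ lapNehari β f, energy f v <
      (1 / 2 - 1 / θ) * √(((2 * α / alphaSharp β) ^ (1 - β))⁻¹) ^ 2 := by
  have h1 : 0 < 1 - β := by linarith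
  have hα := hf.α_pos
  have hθ : 0 < θ - 2 := by linarith [hf.two_lt]
  have hp : 2 < p := by linarith [hf.lt_p, hf.two_lt]
  have hp2 : 0 < p - 2 := by linarith
  have hC : 0 < Cp := by linarith [hf.one_lt]
  have ha : 0 < alphaSharp β :=
    mul_pos four_pos (Real.rpow_pos_of_pos (by positivity) _)
  have hne := hf.nehariP_nonempty hβ hβ1
  have hm := mp_pos hβ hβ1 hp hne
  have hθ0 : 0 < θ := by linarith
  set Y := (2 * α / alphaSharp β) ^ (1 - β) with hY
  have hY0 : 0 < Y := by positivity
  rw [Real.sq_sqrt (by positivity)]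
  have h2 : 2 * θ * mp β p / (θ - 2) * Y < Cp ^ (2 / (p - 2)) := by
    have h3 := Real.rpow_lt_rpow (by positivity) hCp (show 0 < 2 / (p - 2) by positivity)
    rwa [← Real.rpow_mul (by positivity), show (p - 2) / 2 * (2 / (p - 2)) = 1 by field_simp,
      Real.rpow_one] at h3
  have h4 : mp β p < (1 / 2 - 1 / θ) * Y⁻¹ * Cp ^ (2 / (p - 2)) := by
    have e : mp β p = (1 / 2 - 1 / θ) * Y⁻¹ * (2 * θ * mp β p / (θ - 2) * Y) := by
      field_simp
    rw [e]
    have : 0 < 1 / 2 - 1 / θ := sub_pos.2 (one_div_lt_one_div_of_lt two_pos hf.two_lt)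
    gcongr
  -- Because the bound on `C_p` is strict, an almost minimiser of `J_p` is enough; `mp` need not be
  -- attained.
  obtain ⟨_, ⟨u, hu, rfl⟩, hlt⟩ := exists_lt_of_csInf_lt (hne.image _) h4
  obtain ⟨h, hh, hsq, hJ⟩ := exists_of_mem_nehariP hβ hβ1 hu
  obtain ⟨v, hv, hle⟩ := hf.exists_energy_le hβ hβ1 hh hsq
  refine ⟨v, hv, hle.trans_lt ?_⟩
  rw [← hJ, Real.rpow_neg hC.le, ← div_eq_mul_inv, div_lt_iff₀ (by positivity)]
  exact hlt

end IsNonlinearity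

end WeightedBiharmonic

end

theorem theorem1p3 (β : ℝ) (hβ0 : 0 < β) (hβ1 : β < 1)
    (f : R4 → ℝ → ℝ) (α₀ θ p Cp δ : ℝ)
    -- critical growth
    (hα₀ : 0 < α₀) (hcrit : HasCriticalGrowth β α₀ f)
    -- continuous on the ball times the line, and radial in the space variable
    (hV1 : ContinuousOn (fun z : R4 × ℝ => f z.1 z.2) (B ×ˢ univ))
    (hV1rad : ∀ x ∈ B, ∀ y ∈ B, ‖x‖ = ‖y‖ → ∀ t, f x t = f y t)
    -- Ambrosetti–Rabinowitz
    (hθ : 2 < θ)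
    (hV2 : ∀ x ∈ B, ∀ t : ℝ, t ≠ 0 →
      0 < θ * primitive f x t ∧ θ * primitive f x t ≤ t * f x t)
    -- monotonicity
    (hV3 : ∀ x ∈ B, StrictMonoOn (fun t : ℝ => f x t / |t|) {t | t ≠ 0})
    -- behaviour at the origin
    (hV4 : ∀ x ∈ B, Tendsto (fun t : ℝ => |f x t| / |t|) (𝓝[≠] 0) (𝓝 0))
    -- lower bound by a power
    (hp : θ < p)
    (hV5 : ∀ x ∈ B, ∀ t : ℝ, Cp * |t| ^ (p - 1) ≤ Real.sign t * f x t)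
    -- size of the constant
    (hδ : 0 < δ)
    (hCp : max 1 ((2 * θ * mp β p / (θ - 2) *
      (2 * (α₀ + δ) / alphaSharp β) ^ (1 - β)) ^ ((p - 2) / 2)) < Cp) :
    0 < mp β p ∧
    ∃ u : R4 → ℝ, IsRadial u ∧ IsWeakSolution β f u ∧
      u ∈ nehari β f ∧ ∀ v ∈ nehari β f, J β f u ≤ J β f v := by
  have hα : 0 < α₀ + δ := by linarith
  obtain ⟨hCp1, hCp2⟩ := max_lt_iff.1 hCp
  -- From here on the growth exponent is `α = α₀ + δ`, the one appearing in the condition on `C_p`.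
  obtain ⟨C, hC, hgrowth⟩ := exists_growth_bound (show α₀ < α₀ + δ by linarith) hα hcrit hV1
    (fun x hx t ht => (hV2 x hx t ht).1.trans_le (hV2 x hx t ht).2) hV3 hV4
  have hf : IsNonlinearity β (α₀ + δ) C θ p Cp f :=
    ⟨hV1, hα, hC, hgrowth, hθ, hV2, hV3, hV4, hp, hCp1, hV5⟩
  refine ⟨mp_pos hβ0 hβ1 (by linarith) (hf.nehariP_nonempty hβ0 hβ1), ?_⟩
  obtain ⟨v, hv, hvM⟩ := hf.exists_subcritical hβ0 hβ1 hCp2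
  have ha : 0 < alphaSharp β := by
    have : 0 < 1 - β := by linarith
    exact mul_pos four_pos (Real.rpow_pos_of_pos (by positivity) _)
  obtain ⟨h, hh, hmin⟩ := hf.exists_minimizer hβ0 hβ1 (by positivity)
    (alpha_mul_rpow_lt hβ1 hα) hv hvM
  have hcrit' := hf.dEnergy_eq_zero_of_minimizer hβ0 hβ1 hh hmin
  obtain ⟨hE, hl⟩ := ev_mem_E hβ0 hβ1 h
  -- Radiality is built in: `evalG` depends on `x` only through its norm.
  refine ⟨ev h, isRadial_evalG β h, ⟨hE, fun φ hφ => ?_⟩,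
    ⟨hE, not_ev_ae_eq_zero hβ0 hβ1 hh.1, ?_⟩, fun v hv => ?_⟩
  · obtain ⟨k, hφk, hlk⟩ := exists_ev_of_mem_E hβ0 hβ1 hφ
    refine ⟨(hf.integrable_ev hβ0 hβ1 h k).congr ?_, ?_⟩
    · filter_upwards [hφk] with x hx
      rw [hx]
    · have h1 := J'_eq_dEnergy (f := f) hβ0 EventuallyEq.rfl hl hφk hlk
      rw [hcrit' k, J'] at h1
      linarith
  · rw [J'_eq_dEnergy hβ0 EventuallyEq.rfl hl EventuallyEq.rfl hl]
    exact hh.2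
  · obtain ⟨k, hvk, hlk⟩ := exists_ev_of_mem_E hβ0 hβ1 hv.1
    rw [J_eq_energy hβ0 EventuallyEq.rfl hl, J_eq_energy hβ0 hvk hlk]
    exact hmin k (mem_lapNehari_of_mem_nehari hβ0 hvk hlk hv)
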